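/- Let $d\ge 1$, let $\Omega\subset\mathbb{R}^d$ be a bounded open set, $1<p<\infty$ and $0<s\le 1$. For $0<s<1$ let $D^s\varphi=D(I_{1-s}\varphi)$ be the Riesz fractional gradient of $\varphi\in C^\infty_c(\mathbb{R}^d)$, where $$I_{1-s}\varphi(x)=\frac{2^s\,\Gamma\left(\frac{d+s+1}{2}\right)}{\pi^{d/2}(d-1+s)\,\Gamma\left(\frac{1-s}{2}\right)}\int_{\mathbb{R}^d}\frac{\varphi(y)}{|x-y|^{d+s-1}}\,dy ,$$ and let $D^1=D$ be the classical gradient. Let $\Lambda^{s,p}_0(\Omega)$ be the closure of $C^\infty_c(\Omega)$ in the norm $\left(\|u\|_{L^p(\mathbb{R}^d)}^p+\|D^su\|_{L^p(\mathbb{R}^d;\mathbb{R}^d)}^p\right)^{1/p}$ (so $\Lambda^{1,p}_0(\Omega)=W^{1,p}_0(\Omega)$), with $D^s$ extended to it by continuity, let $\Lambda^{-s,p'}(\Omega)$ be its dual space, with duality pairing $\langle\cdot,\cdot\rangle$, and for $u\in\Lambda^{s,p}_0(\Omega)$ let $\Delta^s_pu\in\Lambda^{-s,p'}(\Omega)$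 be given by $\langle\Delta^s_pu,g\rangle=-\int_{\mathbb{R}^d}|D^su|^{p-2}D^su\cdot D^sg\,dx$. Let $p^*_s=\frac{dp}{d-sp}$ if $sp<d$ and $p^*_s=\infty$ otherwise; let $q,q'\in[1,\infty]$ satisfy $\frac1q+\frac1{q'}=1$ and $q'<p^*_s$. Let $v\in L^{q'}(\Omega)$, let $\lambda_+,\lambda_-\in L^q(\Omega)$ with $\lambda_\pm\ge 0$ a.e. in $\Omega$, and put, with $t^\pm=\max\{\pm t,0\}$, $$\Psi_v(w)=\int_\Omega\left(\lambda_+(w-v)^++\lambda_-(w-v)^-\right)dx,\qquad w\in\Lambda^{s,p}_0(\Omega).$$ Let $f\in\Lambda^{-s,p'}(\Omega)$. Then $\Psi_v(w)$ is finite (its integrand is integrable on $\Omega$) for every $w\in\Lambda^{s,p}_0(\Omega)$, and there is a unique $u\in\Lambda^{s,p}_0(\Omega)$ such that $$\Psi_v(w)-\Psi_v(u)\ge\langle f+\Delta^s_pu,\,w-u\rangle\qquad\text{for all } w\in\Lambda^{s,p}_0(\Omega).$$ Moreover, for $u\in\Lambda^{s,p}_0(\Omega)$ this variational inequality is equivalent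 to $f+\Delta^s_pu\in\partial\Psi_v(u)$, where $\partial\Psi_v(u)\subset\Lambda^{-s,p'}(\Omega)$ is the subdifferential, and it is also equivalent to $u$ being a minimizer over $\Lambda^{s,p}_0(\Omega)$ of $$J^s_p(w)=\frac1p\int_{\mathbb{R}^d}|D^sw|^p\,dx+\Psi_v(w)-\langle f,w\rangle .$$ -/

import Mathlib

open MeasureTheory TopologicalSpace
open scoped ENNReal Distributions Gradient

noncomputable section

/-- The Riesz potential `I_α φ` of order `α = 1 - s` on `ℝ^d`, for `0 < s < 1`, that is
`c ∫ φ(y) / |x - y|^(d + s - 1) dy` with the usual normalising constant `c`. -/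
def rieszPotential {d : ℕ} (s : ℝ) (φ : EuclideanSpace ℝ (Fin d) → ℝ)
    (x : EuclideanSpace ℝ (Fin d)) : ℝ :=
  (2 ^ s * Real.Gamma ((d + s + 1) / 2)) /
      (Real.pi ^ ((d : ℝ) / 2) * (d - 1 + s) * Real.Gamma ((1 - s) / 2)) *
    ∫ y, φ y / ‖x - y‖ ^ ((d : ℝ) + s - 1)

/-- The Riesz fractional gradient `D^s φ = D (I_{1-s} φ)` of a smooth compactly supported
function, for `0 < s < 1`; for `s = 1` it is the classical gradient `D φ`. -/
def fracGradient {d : ℕ} (s : ℝ) (φ : EuclideanSpace ℝ (Fin d) → ℝ) :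
    EuclideanSpace ℝ (Fin d) → EuclideanSpace ℝ (Fin d) :=
  if s = 1 then ∇ φ else ∇ (rieszPotential s φ)

instance factOneLeOfReal (p : ℝ) [hp : Fact (1 < p)] : Fact (1 ≤ ENNReal.ofReal p) :=
  ⟨by simpa using hp.out.le⟩

/-- The space of pairs `(u, G)` with `u ∈ L^p(ℝ^d)` and `G ∈ L^p(ℝ^d; ℝ^d)`, with the norm
`(‖u‖_p ^ p + ‖G‖_p ^ p) ^ (1 / p)`. -/
abbrev LpPair (d : ℕ) (p : ℝ) : Type :=
  WithLp (ENNReal.ofReal p)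
    (Lp ℝ (ENNReal.ofReal p) (volume : Measure (EuclideanSpace ℝ (Fin d))) ×
      Lp (EuclideanSpace ℝ (Fin d)) (ENNReal.ofReal p)
        (volume : Measure (EuclideanSpace ℝ (Fin d))))

/-- The Lions-Calderón space `Λ^{s,p}_0(Ω)`: the closure of `C^∞_c(Ω)` in the norm
`(‖u‖_p ^ p + ‖D^s u‖_p ^ p) ^ (1 / p)` over `ℝ^d`. It is realised as the closure of the graph
`{(φ, D^s φ) : φ ∈ C^∞_c(Ω)}` (a linear subspace) in `L^p(ℝ^d) × L^p(ℝ^d; ℝ^d)`; the second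
component of an element is the (weak) fractional gradient of the first one, by which it is
determined, `D^s` being closable. For `s = 1` this is `W^{1,p}_0(Ω)`. -/
def lionsCalderon {d : ℕ} (s p : ℝ) [Fact (1 < p)] (Ω : Opens (EuclideanSpace ℝ (Fin d))) :
    Submodule ℝ (LpPair d p) :=
  (Submodule.span ℝ
    {x : LpPair d p | ∃ φ : 𝓓(Ω, ℝ), x.fst =ᵐ[volume] φ ∧
      x.snd =ᵐ[volume] fracGradient s φ}).topologicalClosure

/-- `Λ^{s,p}_0(Ω)` as a type; it inherits the norm
`(‖u‖_p ^ p + ‖D^s u‖_p ^ p) ^ (1 / p)`. -/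
abbrev LionsCalderon {d : ℕ} (s p : ℝ) [Fact (1 < p)] (Ω : Opens (EuclideanSpace ℝ (Fin d))) :
    Type :=
  lionsCalderon s p Ω

section

variable {d : ℕ} {s p : ℝ} [Fact (1 < p)] {Ω : Opens (EuclideanSpace ℝ (Fin d))}

/-- The function underlying an element of `Λ^{s,p}_0(Ω)`. -/
def LionsCalderon.fn (u : LionsCalderon s p Ω) : EuclideanSpace ℝ (Fin d) → ℝ :=
  (u : LpPair d p).fst

/-- The fractional gradient `D^s u` of an element `u` of `Λ^{s,p}_0(Ω)`. -/
def LionsCalderon.grad (u : LionsCalderon s p Ω) :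
    EuclideanSpace ℝ (Fin d) → EuclideanSpace ℝ (Fin d) :=
  (u : LpPair d p).snd

end

/-- `|G|^(p-2) G` belongs to `L^{p'}` for `G` in `L^p`. -/
theorem memLp_norm_rpow_smul {d : ℕ} {p : ℝ} [hp : Fact (1 < p)]
    (G : Lp (EuclideanSpace ℝ (Fin d)) (ENNReal.ofReal p)
      (volume : Measure (EuclideanSpace ℝ (Fin d)))) :
    MemLp (fun x => ‖G x‖ ^ (p - 2) • G x) (ENNReal.ofReal (p / (p - 1))) volume := by
  have hp1 : 1 < p := hp.out
  have h := (Lp.memLp G).norm_rpow_div (ENNReal.ofReal (p - 1))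
  rw [ENNReal.toReal_ofReal (by linarith), ← ENNReal.ofReal_div_of_pos (by linarith)] at h
  refine (memLp_congr_norm ?_ h.1 ?_).2 h
  · have hm : AEMeasurable (fun x => G x) volume := (Lp.aestronglyMeasurable G).aemeasurable
    exact ((hm.norm.pow_const _).smul hm).aestronglyMeasurable
  · filter_upwards with x
    rw [norm_smul, Real.norm_of_nonneg (by positivity), Real.norm_of_nonneg (by positivity)]
    rcases eq_or_ne (G x) 0 with h0 | h0
    · simp [h0, Real.zero_rpow (by linarith : p - 1 ≠ 0)]
    · rw [← Real.rpow_add_one (norm_ne_zero_iff.2 h0)]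
      congr 1
      ring

/-- The pairing of `|D^s u|^(p-2) D^s u` with fractional gradients is linear and continuous. -/
theorem exists_dual_fracPLaplacian {d : ℕ} {s p : ℝ} [hp : Fact (1 < p)]
    {Ω : Opens (EuclideanSpace ℝ (Fin d))} (u : LionsCalderon s p Ω) :
    ∃ L : StrongDual ℝ (LionsCalderon s p Ω), ∀ g,
      L g = -∫ x, inner ℝ (‖u.grad x‖ ^ (p - 2) • u.grad x) (g.grad x) := by
  have hconj : (ENNReal.ofReal (p / (p - 1))).HolderConjugate (ENNReal.ofReal p) :=
    (Real.HolderConjugate.conjExponent hp.out).symm.ennrealOfReal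
  have hone : Fact (1 ≤ ENNReal.ofReal (p / (p - 1))) := by
    refine ⟨?_⟩
    have : 1 ≤ p / (p - 1) := by
      rw [le_div_iff₀ (by linarith [hp.out])]
      linarith
    simpa using this
  have hmem := memLp_norm_rpow_smul (u : LpPair d p).snd
  refine ⟨-(((innerSL ℝ).lpPairing volume (ENNReal.ofReal (p / (p - 1))) (ENNReal.ofReal p)
    hmem.toLp) ∘L (WithLp.sndL (ENNReal.ofReal p) ℝ _ _) ∘L (lionsCalderon s p Ω).subtypeL), ?_⟩
  intro g
  simp only [neg_apply, ContinuousLinearMap.comp_apply,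
    ContinuousLinearMap.lpPairing_eq_integral]
  congr 1
  refine integral_congr_ae ?_
  filter_upwards [hmem.coeFn_toLp] with x hx
  rw [hx]
  rfl

/-- The fractional `p`-Laplacian `Δ^s_p u = D^s · (|D^s u|^(p-2) D^s u)`, as the element
`g ↦ - ∫ |D^s u|^(p-2) D^s u · D^s g dx` of the dual space `Λ^{-s,p'}(Ω)`. -/
def fracPLaplacian {d : ℕ} {s p : ℝ} [Fact (1 < p)]
    {Ω : Opens (EuclideanSpace ℝ (Fin d))} (u : LionsCalderon s p Ω) :
    StrongDual ℝ (LionsCalderon s p Ω) where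
  toFun g := -∫ x, inner ℝ (‖u.grad x‖ ^ (p - 2) • u.grad x) (g.grad x)
  map_add' g h := by
    obtain ⟨L, hL⟩ := exists_dual_fracPLaplacian u
    simp only [← hL, map_add]
  map_smul' c g := by
    obtain ⟨L, hL⟩ := exists_dual_fracPLaplacian u
    simp only [← hL, map_smul, RingHom.id_apply]
  cont := by
    obtain ⟨L, hL⟩ := exists_dual_fracPLaplacian u
    simpa only [← hL] using L.continuous

/-- The integrand `λ₊ (w - v)^+ + λ₋ (w - v)^-` of `Ψ_v(w)`, with `t^± = max {± t, 0}`. -/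
def psiIntegrand {d : ℕ} (lp lm v w : EuclideanSpace ℝ (Fin d) → ℝ)
    (x : EuclideanSpace ℝ (Fin d)) : ℝ :=
  lp x * max (w x - v x) 0 + lm x * max (-(w x - v x)) 0

/-- The functional `Ψ_v(w) = ∫_Ω (λ₊ (w - v)^+ + λ₋ (w - v)^-) dx` on `Λ^{s,p}_0(Ω)`. -/
def psiFunctional {d : ℕ} {s p : ℝ} [Fact (1 < p)] {Ω : Opens (EuclideanSpace ℝ (Fin d))}
    (lp lm v : EuclideanSpace ℝ (Fin d) → ℝ) (w : LionsCalderon s p Ω) : ℝ :=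
  ∫ x in Ω, psiIntegrand lp lm v w.fn x

/-- The functional
`J(w) = (1/p) ∫ |D^s w|^p dx + Ψ_v(w) - ⟨f, w⟩` on `Λ^{s,p}_0(Ω)`. -/
def energyFunctional {d : ℕ} {s p : ℝ} [Fact (1 < p)] {Ω : Opens (EuclideanSpace ℝ (Fin d))}
    (lp lm v : EuclideanSpace ℝ (Fin d) → ℝ) (f : StrongDual ℝ (LionsCalderon s p Ω))
    (w : LionsCalderon s p Ω) : ℝ :=
  1 / p * (∫ x, ‖w.grad x‖ ^ p) + psiFunctional lp lm v w - f w

/-- The subdifferential `∂Ψ(u)`, a subset of the dual space. -/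
def subdifferential {E : Type*} [NormedAddCommGroup E] [NormedSpace ℝ E] (Ψ : E → ℝ) (u : E) :
    Set (StrongDual ℝ E) :=
  {ζ | ∀ w, Ψ u + ζ (w - u) ≤ Ψ w}

/-- The critical Sobolev exponent `p*_s`: `d p / (d - s p)` if `s p < d`, and `∞` otherwise. -/
def sobolevExponent (d : ℕ) (s p : ℝ) : ℝ≥0∞ :=
  if s * p < d then ENNReal.ofReal (d * p / (d - s * p)) else ∞

end

section

open Set Metric Filter Topology
open scoped NNReal

/-! ### Power kernels on `ℝ^d` -/

section PowerKernels

variable {d : ℕ}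

/-! The variational inequality is the first-order optimality condition for the convex energy `J`, so
everything reduces to minimizing `J`. The subdifferential form is the same inequality with its terms
rearranged.

The analytic input is the subcritical Sobolev inequality `‖w‖_r ≤ C ‖D^s w‖_p` on a bounded set
(`exists_eLpNorm_fn_le`). With `r = q'` and Hölder it makes `Ψ_v` finite and continuous; with `r =
p` it is Poincaré's inequality, which gives coercivity. It comes from recovering `φ` from `D^s φ`.
For `s < 1`, `D^s φ` is a multiple of the gradient of `|·|^(-a) * φ` with `a = d + s - 1`.
Convolving it with the odd kernel `|y|^(-b) y`, `b = d - s + 1`, produces the convolution of the two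
kernels acting on `∇φ`. By homogeneity and rotation invariance that convolution is a positive
multiple of `|w|^(-d) w`, and the classical representation formula then returns `φ`. As the tail of
the integral is small relative to `‖φ‖_1`, only a truncated kernel `|y|^(-(d-s))` remains
(`exists_abs_le_setIntegral_fracGradient`). Young's inequality and absorption of the `L^1` error
finish the estimate for test functions, and Fatou's lemma carries it to the closure.

The minimizer is found without weak compactness. A compactness argument in finite dimension gives a
quantitative strict convexity of `|·|^p`, which integrates to uniform convexity of `L^p`
(`Lp.exists_norm_sub_rpow_le`). Two near-minimizers are then close, since the energy of their
midpoint cannot drop below the infimum; this yields both a Cauchy minimizing sequence and uniqueness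
(`existsUnique_minimizer`).

A solution minimizes because `-Δ^s_p` is a subgradient of the Dirichlet energy. Conversely, a
minimizer is compared with points on a segment issuing from it, and continuity of `Δ^s_p` along the
segment gives the inequality (`variationalInequality_iff_isMin`). -/

theorem measurable_norm_rpow (b : ℝ) :
    Measurable fun y : EuclideanSpace ℝ (Fin d) => ‖y‖ ^ b :=
  measurable_norm.pow_const b

theorem integrableOn_ball_norm_rpow [NeZero d] {b : ℝ} (hb : b < d) (R : ℝ) :
    IntegrableOn (fun y : EuclideanSpace ℝ (Fin d) => ‖y‖ ^ (-b)) (ball 0 R) := by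
  rcases le_or_gt R 0 with hR | hR
  · simp [ball_eq_empty.2 hR]
  have hd : 1 ≤ d := NeZero.one_le
  refine (integrableOn_fun_norm_addHaar (volume : Measure (EuclideanSpace ℝ (Fin d)))
    (f := fun t : ℝ => t ^ (-b))).2 ?_
  have h : IntegrableOn (fun t : ℝ => t ^ ((d : ℝ) - 1 - b)) (Ioo 0 R) :=
    (intervalIntegral.integrableOn_Ioo_rpow_iff hR).2 (by linarith)
  refine h.congr_fun (fun t ht => ?_) measurableSet_Ioo
  have ht0 : 0 < t := ht.1
  simp only [finrank_euclideanSpace, Fintype.card_fin, smul_eq_mul]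
  rw [← Real.rpow_natCast, ← Real.rpow_add ht0, Nat.cast_sub hd,
    Nat.cast_one, sub_eq_add_neg ((d : ℝ) - 1)]

theorem integrableOn_norm_rpow_of_isBounded [NeZero d] {b : ℝ} (hb : b < d)
    {s : Set (EuclideanSpace ℝ (Fin d))} (hs : Bornology.IsBounded s) :
    IntegrableOn (fun y : EuclideanSpace ℝ (Fin d) => ‖y‖ ^ (-b)) s := by
  obtain ⟨R, hR⟩ := hs.subset_ball 0
  exact (integrableOn_ball_norm_rpow hb R).mono_set hR

theorem locallyIntegrable_norm_rpow [NeZero d] {b : ℝ} (hb : b < d) :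
    LocallyIntegrable (fun y : EuclideanSpace ℝ (Fin d) => ‖y‖ ^ (-b)) := by
  refine (locallyIntegrable_iff).2 fun k hk => ?_
  exact integrableOn_norm_rpow_of_isBounded hb hk.isBounded

theorem integrableOn_compl_ball_norm_rpow {b : ℝ} (hb : (d : ℝ) < b) {R : ℝ} (hR : 0 < R) :
    IntegrableOn (fun y : EuclideanSpace ℝ (Fin d) => ‖y‖ ^ (-b)) (ball 0 R)ᶜ := by
  have hb0 : 0 < b := lt_of_le_of_lt (Nat.cast_nonneg d) hb
  have h : Integrable (fun y : EuclideanSpace ℝ (Fin d) => (1 + ‖y‖) ^ (-b)) :=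
    integrable_one_add_norm (by simpa using hb)
  -- The factor comes from `1 + |y| ≤ (1/R + 1) |y|` when `|y| ≥ R`.
  have h2 := (h.const_mul ((1 / R + 1) ^ b)).integrableOn (s := (ball 0 R)ᶜ)
  refine h2.mono' (measurable_norm_rpow (-b)).aestronglyMeasurable ?_
  filter_upwards [ae_restrict_mem measurableSet_ball.compl] with y hy
  have hy' : R ≤ ‖y‖ := by simpa using hy
  have hy0 : 0 < ‖y‖ := hR.trans_le hy'
  rw [Real.norm_of_nonneg (by positivity), Real.rpow_neg hy0.le, Real.rpow_neg (by positivity),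
    ← div_eq_mul_inv, ← Real.div_rpow (by positivity) (by positivity),
    ← Real.inv_rpow hy0.le]
  refine Real.rpow_le_rpow (by positivity) ?_ hb0.le
  rw [le_div_iff₀ (by positivity), inv_mul_le_iff₀ hy0]
  have : 1 ≤ ‖y‖ / R := (one_le_div hR).2 hy'
  calc 1 + ‖y‖ ≤ ‖y‖ / R + ‖y‖ := by linarith
    _ = ‖y‖ * (1 / R + 1) := by ring

/-- Mean value theorem on `[ρ, ∞)`. The extra power of decay it provides is what makes the
symmetrized kernel integrable at infinity and the gradient of the potential small far from the
support. -/
theorem abs_rpow_neg_sub_rpow_neg_le {a ρ t u : ℝ} (ha : 0 ≤ a) (hρ : 0 < ρ) (ht : ρ ≤ t)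
    (hu : ρ ≤ u) : |t ^ (-a) - u ^ (-a)| ≤ a * ρ ^ (-a - 1) * |t - u| := by
  have := Convex.norm_image_sub_le_of_norm_deriv_le (𝕜 := ℝ) (f := fun x : ℝ => x ^ (-a))
    (s := Ici ρ) (x := u) (y := t) (C := a * ρ ^ (-a - 1)) ?_ ?_ (convex_Ici ρ) hu ht
  · simpa [Real.norm_eq_abs] using this
  · intro x hx
    exact (Real.hasDerivAt_rpow_const (Or.inl (hρ.trans_le hx).ne')).differentiableAt
  · intro x hx
    have hx0 : 0 < x := hρ.trans_le hx
    rw [(Real.hasDerivAt_rpow_const (Or.inl hx0.ne')).deriv, norm_mul, norm_neg,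
      Real.norm_of_nonneg ha, Real.norm_of_nonneg (by positivity)]
    exact mul_le_mul_of_nonneg_left
      (Real.rpow_le_rpow_of_nonpos hρ hx (by linarith)) ha

theorem abs_norm_rpow_neg_sub_le {E : Type*} [NormedAddCommGroup E] {a ρ : ℝ} (ha : 0 ≤ a)
    (hρ : 0 < ρ) {y z : E} (hy : ρ ≤ ‖y‖) (hz : ρ ≤ ‖z‖) :
    |‖y‖ ^ (-a) - ‖z‖ ^ (-a)| ≤ a * ρ ^ (-a - 1) * ‖y - z‖ :=
  (abs_rpow_neg_sub_rpow_neg_le ha hρ hy hz).trans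
    (mul_le_mul_of_nonneg_left (abs_norm_sub_norm_le y z) (by positivity))

/-- Integration in polar coordinates. -/
theorem integral_eq_integral_toSphere [NeZero d] {F : EuclideanSpace ℝ (Fin d) → ℝ}
    (hF : Integrable F) :
    ∫ y, F y = ∫ ω : sphere (0 : EuclideanSpace ℝ (Fin d)) 1,
      (∫ r in Ioi (0 : ℝ), r ^ (d - 1) * F (r • (ω : EuclideanSpace ℝ (Fin d))))
        ∂(volume : Measure (EuclideanSpace ℝ (Fin d))).toSphere := by
  set μ : Measure (EuclideanSpace ℝ (Fin d)) := volume with hμ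
  have hmp := μ.measurePreserving_homeomorphUnitSphereProd
  have hmp' := hmp.symm (homeomorphUnitSphereProd (EuclideanSpace ℝ (Fin d))).toMeasurableEquiv
  have hdim : Module.finrank ℝ (EuclideanSpace ℝ (Fin d)) = d := by simp
  rw [hdim] at hmp hmp'
  have hint : Integrable (fun x : ({(0)}ᶜ : Set (EuclideanSpace ℝ (Fin d))) => F x)
      (μ.comap (↑)) := by
    have := (integrableOn_iff_comap_subtypeVal (μ := μ) (f := F)
      (measurableSet_singleton (0 : EuclideanSpace ℝ (Fin d))).compl).1 hF.integrableOn
    exact this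
  have hint2 := hmp'.integrable_comp_of_integrable hint
  calc ∫ y, F y ∂μ
      = ∫ x : ({(0)}ᶜ : Set (EuclideanSpace ℝ (Fin d))), F x ∂(μ.comap (↑)) := by
        rw [integral_subtype_comap (measurableSet_singleton _).compl F, restrict_compl_singleton]
    _ = ∫ x, F ((homeomorphUnitSphereProd (EuclideanSpace ℝ (Fin d))).symm x : _)
          ∂(μ.toSphere.prod (.volumeIoiPow (d - 1))) :=
        (hmp'.integral_comp' _).symm
    _ = ∫ ω, (∫ r : Ioi (0 : ℝ), F ((r : ℝ) • (ω : EuclideanSpace ℝ (Fin d)))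
          ∂(.volumeIoiPow (d - 1))) ∂μ.toSphere := by
        exact integral_prod _ hint2
    _ = _ := by
        refine integral_congr_ae (Eventually.of_forall fun ω => ?_)
        simp only [Measure.volumeIoiPow, ENNReal.ofReal]
        rw [integral_withDensity_eq_integral_smul (by fun_prop), integral_subtype_comap
          measurableSet_Ioi (fun a : ℝ => Real.toNNReal (a ^ (d - 1)) •
            F (a • (ω : EuclideanSpace ℝ (Fin d))))]
        refine setIntegral_congr_fun measurableSet_Ioi fun x hx => ?_
        simp only [NNReal.smul_def, Real.coe_toNNReal _ (pow_nonneg hx.out.le _), smul_eq_mul]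

end PowerKernels

/-! ### The odd kernel `|y|^(-b) y` and the classical representation by the gradient -/

section VectorKernel

variable {d : ℕ}

/-- The odd vector field `|y|^(-b) y`. -/
noncomputable def vecKernel (b : ℝ) (y : EuclideanSpace ℝ (Fin d)) : EuclideanSpace ℝ (Fin d) :=
  ‖y‖ ^ (-b) • y

theorem vecKernel_neg (b : ℝ) (y : EuclideanSpace ℝ (Fin d)) :
    vecKernel b (-y) = -vecKernel b y := by
  simp [vecKernel]

theorem measurable_vecKernel (b : ℝ) :
    Measurable (vecKernel b : EuclideanSpace ℝ (Fin d) → EuclideanSpace ℝ (Fin d)) :=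
  (measurable_norm_rpow (-b)).smul measurable_id

theorem norm_vecKernel_le (b : ℝ) (y : EuclideanSpace ℝ (Fin d)) :
    ‖vecKernel b y‖ ≤ ‖y‖ ^ (-(b - 1)) := by
  rw [vecKernel, norm_smul, Real.norm_of_nonneg (by positivity)]
  -- Only an inequality holds at the origin: for `b = 1` the right side is `0 ^ 0 = 1`.
  rcases eq_or_ne y 0 with rfl | hy
  · simpa using Real.rpow_nonneg le_rfl _
  · rw [← Real.rpow_add_one (norm_ne_zero_iff.2 hy)]
    exact le_of_eq (by congr 1; ring)

theorem locallyIntegrable_vecKernel [NeZero d] {b : ℝ} (hb : b - 1 < d) :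
    LocallyIntegrable
      (vecKernel b : EuclideanSpace ℝ (Fin d) → EuclideanSpace ℝ (Fin d)) := by
  refine (locallyIntegrable_norm_rpow hb).mono (measurable_vecKernel b).aestronglyMeasurable ?_
  filter_upwards with y
  exact (norm_vecKernel_le b y).trans (Real.le_norm_self _)

theorem integrable_inner_vecKernel [NeZero d] {b : ℝ} (hb : b - 1 < d)
    {g : EuclideanSpace ℝ (Fin d) → EuclideanSpace ℝ (Fin d)} (hg : Continuous g)
    (hgc : HasCompactSupport g) (x : EuclideanSpace ℝ (Fin d)) :
    Integrable fun y => inner ℝ (vecKernel b y) (g (x - y)) :=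
  hgc.convolutionExists_right (innerSL ℝ) (locallyIntegrable_vecKernel hb) hg x

theorem continuous_gradient {φ : EuclideanSpace ℝ (Fin d) → ℝ} (hφ : ContDiff ℝ 1 φ) :
    Continuous (∇ φ) :=
  (InnerProductSpace.toDual ℝ _).symm.continuous.comp (hφ.continuous_fderiv one_ne_zero)

theorem HasCompactSupport.gradient {φ : EuclideanSpace ℝ (Fin d) → ℝ}
    (hc : HasCompactSupport φ) : HasCompactSupport (∇ φ) :=
  (hc.fderiv (𝕜 := ℝ)).comp_left (g := (InnerProductSpace.toDual ℝ _).symm) (map_zero _)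

/-- The surface measure of the unit sphere. -/
noncomputable def sphereArea (d : ℕ) : ℝ :=
  (volume : Measure (EuclideanSpace ℝ (Fin d))).toSphere.real univ

theorem sphereArea_pos (d : ℕ) [NeZero d] : 0 < sphereArea d := by
  rw [sphereArea, Measure.real, ENNReal.toReal_pos_iff]
  refine ⟨?_, measure_lt_top _ _⟩
  rw [pos_iff_ne_zero, Measure.measure_univ_ne_zero]
  exact Measure.toSphere_ne_zero _

/-- The representation of a compactly supported function by its gradient. -/
theorem integral_inner_vecKernel_gradient [NeZero d] {φ : EuclideanSpace ℝ (Fin d) → ℝ}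
    (hφ : ContDiff ℝ 1 φ) (hc : HasCompactSupport φ) (x : EuclideanSpace ℝ (Fin d)) :
    ∫ y, inner ℝ (vecKernel d y) (∇ φ (x - y)) = sphereArea d * φ x := by
  have hint := integrable_inner_vecKernel (b := d) (by linarith) (continuous_gradient hφ)
    hc.gradient x
  rw [integral_eq_integral_toSphere hint]
  -- The Jacobian `r^(d-1)` cancels the size of the kernel, leaving the derivative of `r ↦ -φ(x -
  -- rω)`. Since `φ` has compact support, every ray contributes exactly `φ x`.
  have key : ∀ ω : sphere (0 : EuclideanSpace ℝ (Fin d)) 1,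
      ∫ r in Ioi (0 : ℝ), r ^ (d - 1) * inner ℝ
        (vecKernel d (r • (ω : EuclideanSpace ℝ (Fin d))))
        (∇ φ (x - r • (ω : EuclideanSpace ℝ (Fin d)))) = φ x := by
    intro ω
    have hω : ‖(ω : EuclideanSpace ℝ (Fin d))‖ = 1 := by simp
    set w := (ω : EuclideanSpace ℝ (Fin d))
    have hd : 1 ≤ d := NeZero.one_le
    have h1 : ∀ r ∈ Ioi (0 : ℝ), r ^ (d - 1) * inner ℝ (vecKernel d (r • w)) (∇ φ (x - r • w))
        = fderiv ℝ φ (x - r • w) w := by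
      intro r hr
      have hr0 : 0 < r := hr
      rw [vecKernel, norm_smul, hω, mul_one, Real.norm_of_nonneg hr0.le, smul_smul,
        inner_smul_left, real_inner_comm, inner_gradient_left, ← mul_assoc]
      have : r ^ (d - 1) * (r ^ (-(d : ℝ)) * r) = 1 := by
        rw [mul_comm _ r, ← mul_assoc, ← pow_succ, Nat.sub_add_cancel hd, Real.rpow_neg hr0.le,
          Real.rpow_natCast, mul_inv_cancel₀ (by positivity)]
      simp only [conj_trivial, this, one_mul]
    rw [setIntegral_congr_fun measurableSet_Ioi h1]
    have hcl : Topology.IsClosedEmbedding fun r : ℝ => x - r • w := by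
      have hw : w ≠ 0 := by
        intro h
        rw [h] at hω
        simp at hω
      exact (Homeomorph.subLeft x).isClosedEmbedding.comp (isClosedEmbedding_smul_left hw)
    have hderiv : ∀ r : ℝ, HasDerivAt (fun r : ℝ => -φ (x - r • w))
        (fderiv ℝ φ (x - r • w) w) r := by
      intro r
      have h2 : HasDerivAt (fun r : ℝ => x - r • w) (-w) r := by
        simpa using ((hasDerivAt_id r).smul_const w).const_sub x
      have h3 := ((hφ.differentiable one_ne_zero (x - r • w)).hasFDerivAt.comp_hasDerivAt r
        h2).neg
      exact h3.congr_deriv (by simp)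
    have hcs : HasCompactSupport fun r : ℝ => fderiv ℝ φ (x - r • w) w :=
      ((hc.fderiv_apply (𝕜 := ℝ) w)).comp_isClosedEmbedding hcl
    have hcont : Continuous fun r : ℝ => fderiv ℝ φ (x - r • w) w := by
      have := hφ.continuous_fderiv one_ne_zero
      fun_prop
    have h4 := integral_Ioi_of_hasDerivAt_of_tendsto (a := (0 : ℝ)) (m := 0)
      (hderiv 0).continuousAt.continuousWithinAt (fun r _ => hderiv r)
      (hcont.integrable_of_hasCompactSupport hcs).integrableOn ?_
    · rw [h4]
      simp
    · have h5 : HasCompactSupport fun r : ℝ => -φ (x - r • w) :=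
        (hc.comp_isClosedEmbedding hcl).neg
      exact h5.is_zero_at_infty.mono_left atTop_le_cocompact
  simp only [key]
  rw [integral_const, smul_eq_mul, sphereArea]

end VectorKernel

/-! ### Convolution of the Riesz kernel with the odd kernel -/

section ConvolutionOfKernels

variable {d : ℕ}

/-- The product `|w - y|^(-a) |y|^(-b) y`, whose integral in `y` is the convolution at `w` of the
Riesz kernel `|·|^(-a)` with the vector kernel `|y|^(-b) y`. -/
noncomputable def kernelProd (a b : ℝ) (w y : EuclideanSpace ℝ (Fin d)) :
    EuclideanSpace ℝ (Fin d) :=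
  ‖w - y‖ ^ (-a) • vecKernel b y

/-- The even part in `y` of `kernelProd`, which decays faster at infinity. -/
noncomputable def evenKernelProd (a b : ℝ) (w y : EuclideanSpace ℝ (Fin d)) :
    EuclideanSpace ℝ (Fin d) :=
  (1 / 2 : ℝ) • (kernelProd a b w y + kernelProd a b w (-y))

theorem measurable_kernelProd (a b : ℝ) :
    Measurable fun z : EuclideanSpace ℝ (Fin d) × EuclideanSpace ℝ (Fin d) =>
      kernelProd a b z.1 z.2 :=
  ((measurable_norm_rpow (-a)).comp (measurable_fst.sub measurable_snd)).smul
    ((measurable_vecKernel b).comp measurable_snd)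

theorem measurable_kernelProd_right (a b : ℝ) (w : EuclideanSpace ℝ (Fin d)) :
    Measurable (kernelProd a b w) :=
  ((measurable_norm_rpow (-a)).comp (measurable_const.sub measurable_id)).smul
    (measurable_vecKernel b)

theorem measurable_evenKernelProd_right (a b : ℝ) (w : EuclideanSpace ℝ (Fin d)) :
    Measurable (evenKernelProd a b w) :=
  ((measurable_kernelProd_right a b w).add
    ((measurable_kernelProd_right a b w).comp measurable_neg)).const_smul (1 / 2 : ℝ)

theorem norm_kernelProd_le (a b : ℝ) (w y : EuclideanSpace ℝ (Fin d)) :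
    ‖kernelProd a b w y‖ ≤ ‖w - y‖ ^ (-a) * ‖y‖ ^ (-(b - 1)) := by
  rw [kernelProd, norm_smul, Real.norm_of_nonneg (by positivity)]
  exact mul_le_mul_of_nonneg_left (norm_vecKernel_le b y) (by positivity)

theorem evenKernelProd_eq (a b : ℝ) (w y : EuclideanSpace ℝ (Fin d)) :
    evenKernelProd a b w y =
      ((1 / 2) * (‖w - y‖ ^ (-a) - ‖w + y‖ ^ (-a))) • vecKernel b y := by
  simp only [evenKernelProd, kernelProd, vecKernel_neg, sub_neg_eq_add]
  module

theorem integrableOn_norm_sub_rpow [NeZero d] {a : ℝ} (ha : a < d)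
    (w : EuclideanSpace ℝ (Fin d)) {s : Set (EuclideanSpace ℝ (Fin d))}
    (hs : Bornology.IsBounded s) :
    IntegrableOn (fun y => ‖w - y‖ ^ (-a)) s := by
  obtain ⟨R, hR⟩ := hs.subset_ball 0
  have hmp := Measure.measurePreserving_sub_left
    (volume : Measure (EuclideanSpace ℝ (Fin d))) w
  have h := (hmp.integrableOn_comp_preimage (MeasurableEquiv.subLeft w).measurableEmbedding
    (f := fun y => ‖y‖ ^ (-a)) (s := ball 0 (‖w‖ + R))).2 (integrableOn_ball_norm_rpow ha _)
  refine h.mono_set fun y hy => ?_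
  have h1 : ‖y‖ < R := by simpa using hR hy
  have := norm_sub_le w y
  simp only [mem_preimage, mem_ball_zero_iff]
  linarith

/-- The singularities at `0` and at `w` are separated by the sphere of radius `|w|/2`: inside it the
factor `|w - y|^(-a)` is bounded, outside it the factor `|y|^(-(b-1))` is. -/
theorem integrableOn_kernelProd [NeZero d] {a b : ℝ} (ha0 : 0 ≤ a) (ha : a < d) (hb1 : 1 ≤ b)
    (hb : b - 1 < d) {w : EuclideanSpace ℝ (Fin d)} (hw : w ≠ 0) (R : ℝ) :
    IntegrableOn (kernelProd a b w) (ball 0 R) := by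
  set r := ‖w‖ / 2 with hr
  have hr0 : 0 < r := by positivity
  have h1 : IntegrableOn (kernelProd a b w) (ball 0 r) := by
    refine ((integrableOn_ball_norm_rpow hb r).const_mul (r ^ (-a))).mono'
      (measurable_kernelProd_right a b w).aestronglyMeasurable ?_
    filter_upwards [ae_restrict_mem measurableSet_ball] with y hy
    have hy : ‖y‖ < r := by simpa using hy
    refine (norm_kernelProd_le a b w y).trans (mul_le_mul_of_nonneg_right ?_ (by positivity))
    refine Real.rpow_le_rpow_of_nonpos hr0 ?_ (by linarith)
    have := norm_sub_norm_le w y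
    linarith
  have h2 : IntegrableOn (kernelProd a b w) (ball 0 R \ ball 0 r) := by
    refine ((integrableOn_norm_sub_rpow ha w (isBounded_ball.subset sdiff_subset)).mul_const
      (r ^ (-(b - 1)))).mono' (measurable_kernelProd_right a b w).aestronglyMeasurable ?_
    filter_upwards [ae_restrict_mem (measurableSet_ball.diff measurableSet_ball)] with y hy
    have hy : r ≤ ‖y‖ := by simpa using hy.2
    refine (norm_kernelProd_le a b w y).trans (mul_le_mul_of_nonneg_left ?_ (by positivity))
    exact Real.rpow_le_rpow_of_nonpos hr0 hy (by linarith)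
  refine (h1.union h2).mono_set fun y hy => ?_
  by_cases h : y ∈ ball (0 : EuclideanSpace ℝ (Fin d)) r
  · exact Or.inl h
  · exact Or.inr ⟨hy, h⟩

theorem neg_preimage_ball (R : ℝ) :
    (fun y : EuclideanSpace ℝ (Fin d) => -y) ⁻¹' ball 0 R = ball 0 R := by
  ext y
  simp

theorem integrableOn_kernelProd_neg [NeZero d] {a b : ℝ} (ha0 : 0 ≤ a) (ha : a < d)
    (hb1 : 1 ≤ b) (hb : b - 1 < d) {w : EuclideanSpace ℝ (Fin d)} (hw : w ≠ 0) (R : ℝ) :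
    IntegrableOn (fun y => kernelProd a b w (-y)) (ball 0 R) := by
  have h := ((Measure.measurePreserving_neg
    (volume : Measure (EuclideanSpace ℝ (Fin d)))).integrableOn_comp_preimage
      (MeasurableEquiv.neg _).measurableEmbedding (f := kernelProd a b w) (s := ball 0 R)).2
      (integrableOn_kernelProd ha0 ha hb1 hb hw R)
  rwa [neg_preimage_ball] at h

/-- Centred balls are symmetric, so the odd part contributes nothing. This is why truncations are
always taken over balls about `0`. -/
theorem setIntegral_evenKernelProd [NeZero d] {a b : ℝ} (ha0 : 0 ≤ a) (ha : a < d)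
    (hb1 : 1 ≤ b) (hb : b - 1 < d) {w : EuclideanSpace ℝ (Fin d)} (hw : w ≠ 0) (R : ℝ) :
    ∫ y in ball 0 R, evenKernelProd a b w y = ∫ y in ball 0 R, kernelProd a b w y := by
  have h := (Measure.measurePreserving_neg
    (volume : Measure (EuclideanSpace ℝ (Fin d)))).setIntegral_preimage_emb
      (MeasurableEquiv.neg _).measurableEmbedding (kernelProd a b w) (ball 0 R)
  rw [neg_preimage_ball] at h
  simp only [evenKernelProd]
  rw [integral_smul, integral_add (integrableOn_kernelProd ha0 ha hb1 hb hw R)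
    (integrableOn_kernelProd_neg ha0 ha hb1 hb hw R), h]
  module

/-- At infinity the product decays only like `|y|^(1-a-b)`, which for `a + b = 2d` is not integrable
when `d = 1`. Symmetrizing replaces `|w - y|^(-a)` by a difference of two such powers and gains one
order, leaving `|y|^(-(a+b))`. -/
theorem integrable_evenKernelProd [NeZero d] {a b : ℝ} (ha0 : 0 ≤ a) (ha : a < d)
    (hb1 : 1 ≤ b) (hb : b - 1 < d) (hab : d < a + b) {w : EuclideanSpace ℝ (Fin d)}
    (hw : w ≠ 0) : Integrable (evenKernelProd a b w) := by
  set R := 2 * ‖w‖ with hR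
  have hw0 : 0 < ‖w‖ := norm_pos_iff.2 hw
  have hR0 : 0 < R := by positivity
  have h1 : IntegrableOn (evenKernelProd a b w) (ball 0 R) :=
    ((integrableOn_kernelProd ha0 ha hb1 hb hw R).add
      (integrableOn_kernelProd_neg ha0 ha hb1 hb hw R)).smul (1 / 2 : ℝ)
  have h2 : IntegrableOn (evenKernelProd a b w) (ball 0 R)ᶜ := by
    refine ((integrableOn_compl_ball_norm_rpow hab hR0).const_mul
      ((1 / 2) * (a * (1 / 2) ^ (-a - 1) * (2 * ‖w‖)))).mono'
      (measurable_evenKernelProd_right a b w).aestronglyMeasurable ?_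
    filter_upwards [ae_restrict_mem measurableSet_ball.compl] with y hy
    have hy : 2 * ‖w‖ ≤ ‖y‖ := by simpa using hy
    have hy0 : 0 < ‖y‖ := by linarith
    have h3 : ‖y‖ / 2 ≤ ‖w - y‖ := by
      have := norm_sub_norm_le y w
      rw [norm_sub_rev] at this
      linarith
    have h4 : ‖y‖ / 2 ≤ ‖w + y‖ := by
      have := norm_sub_norm_le y (-w)
      rw [norm_neg, sub_neg_eq_add, add_comm y] at this
      linarith
    have h5 : |‖w - y‖ ^ (-a) - ‖w + y‖ ^ (-a)| ≤ a * (‖y‖ / 2) ^ (-a - 1) * (2 * ‖w‖) := by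
      rw [norm_sub_rev] at h3 ⊢
      refine (abs_norm_rpow_neg_sub_le ha0 (by positivity) h3 h4).trans ?_
      have : ‖y - w - (w + y)‖ = 2 * ‖w‖ := by
        rw [show y - w - (w + y) = (-2 : ℝ) • w by module, norm_smul]
        norm_num
      rw [this]
    rw [evenKernelProd_eq, norm_smul, norm_mul, Real.norm_of_nonneg (by norm_num : (0 : ℝ) ≤ 1 / 2),
      Real.norm_eq_abs]
    calc 1 / 2 * |‖w - y‖ ^ (-a) - ‖w + y‖ ^ (-a)| * ‖vecKernel b y‖
        ≤ 1 / 2 * (a * (‖y‖ / 2) ^ (-a - 1) * (2 * ‖w‖)) * ‖y‖ ^ (-(b - 1)) := by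
          gcongr
          exact norm_vecKernel_le b y
      _ = 1 / 2 * (a * (1 / 2) ^ (-a - 1) * (2 * ‖w‖)) * (‖y‖ ^ (-a - 1) * ‖y‖ ^ (-(b - 1))) := by
          rw [div_eq_mul_one_div ‖y‖ 2, Real.mul_rpow hy0.le (by norm_num)]
          ring
      _ = 1 / 2 * (a * (1 / 2) ^ (-a - 1) * (2 * ‖w‖)) * ‖y‖ ^ (-(a + b)) := by
          rw [← Real.rpow_add hy0]
          ring_nf
  have := h1.union h2
  rwa [union_compl_self, integrableOn_univ] at this

/-- The (conditionally convergent) convolution of `|·|^(-a)` with `|y|^(-b) y`. -/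
noncomputable def kernelConv (a b : ℝ) (w : EuclideanSpace ℝ (Fin d)) :
    EuclideanSpace ℝ (Fin d) :=
  ∫ y, evenKernelProd a b w y

theorem evenKernelProd_smul (a b : ℝ) {t : ℝ} (ht : 0 < t) (w y : EuclideanSpace ℝ (Fin d)) :
    evenKernelProd a b (t • w) (t • y) = t ^ (1 - a - b) • evenKernelProd a b w y := by
  simp only [evenKernelProd_eq, vecKernel, ← smul_sub, ← smul_add, norm_smul,
    Real.norm_of_nonneg ht.le, Real.mul_rpow ht.le (norm_nonneg _), smul_smul]
  congr 1
  rw [show 1 - a - b = -a + -b + 1 by ring, Real.rpow_add_one ht.ne', Real.rpow_add ht]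
  ring

theorem evenKernelProd_map (a b : ℝ)
    (O : EuclideanSpace ℝ (Fin d) ≃ₗᵢ[ℝ] EuclideanSpace ℝ (Fin d))
    (w y : EuclideanSpace ℝ (Fin d)) :
    evenKernelProd a b (O w) (O y) = O (evenKernelProd a b w y) := by
  simp only [evenKernelProd_eq, vecKernel, ← map_sub, ← map_add, O.norm_map, map_smul]

theorem integral_comp_smul_pos {F : Type*} [NormedAddCommGroup F] [NormedSpace ℝ F]
    (f : EuclideanSpace ℝ (Fin d) → F) {t : ℝ} (ht : 0 < t) :
    ∫ y, f y = t ^ (d : ℝ) • ∫ y, f (t • y) := by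
  rw [Measure.integral_comp_smul, finrank_euclideanSpace, Fintype.card_fin, Real.rpow_natCast,
    abs_of_pos (by positivity), smul_smul, mul_inv_cancel₀ (by positivity), one_smul]

theorem kernelConv_smul (a b : ℝ) {t : ℝ} (ht : 0 < t) (w : EuclideanSpace ℝ (Fin d)) :
    kernelConv a b (t • w) = t ^ (d + 1 - a - b) • kernelConv a b w := by
  rw [kernelConv, integral_comp_smul_pos _ ht]
  simp only [evenKernelProd_smul a b ht]
  rw [integral_smul, smul_smul, ← Real.rpow_add ht, kernelConv]
  ring_nf

theorem integral_norm_evenKernelProd_smul (a b : ℝ) {t : ℝ} (ht : 0 < t)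
    (w : EuclideanSpace ℝ (Fin d)) :
    ∫ y, ‖evenKernelProd a b (t • w) y‖ =
      t ^ (d + 1 - a - b) * ∫ y, ‖evenKernelProd a b w y‖ := by
  rw [integral_comp_smul_pos _ ht]
  simp only [evenKernelProd_smul a b ht, norm_smul,
    Real.norm_of_nonneg (Real.rpow_nonneg ht.le (1 - a - b))]
  rw [integral_const_mul, smul_eq_mul, ← mul_assoc, ← Real.rpow_add ht]
  ring_nf

theorem kernelConv_map (a b : ℝ)
    (O : EuclideanSpace ℝ (Fin d) ≃ₗᵢ[ℝ] EuclideanSpace ℝ (Fin d))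
    (w : EuclideanSpace ℝ (Fin d)) : kernelConv a b (O w) = O (kernelConv a b w) := by
  rw [kernelConv, ← O.measurePreserving.integral_comp O.toHomeomorph.measurableEmbedding]
  simp only [evenKernelProd_map]
  exact O.toContinuousLinearEquiv.integral_comp_comm _

theorem integral_norm_evenKernelProd_map (a b : ℝ)
    (O : EuclideanSpace ℝ (Fin d) ≃ₗᵢ[ℝ] EuclideanSpace ℝ (Fin d))
    (w : EuclideanSpace ℝ (Fin d)) :
    ∫ y, ‖evenKernelProd a b (O w) y‖ = ∫ y, ‖evenKernelProd a b w y‖ := by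
  rw [← O.measurePreserving.integral_comp O.toHomeomorph.measurableEmbedding]
  simp only [evenKernelProd_map, O.norm_map]

theorem inner_evenKernelProd (a b : ℝ) (w y : EuclideanSpace ℝ (Fin d)) :
    inner ℝ w (evenKernelProd a b w y) =
      (1 / 2) * ‖y‖ ^ (-b) * ((‖w - y‖ ^ (-a) - ‖w + y‖ ^ (-a)) * inner ℝ w y) := by
  simp only [evenKernelProd_eq, vecKernel, inner_smul_right]
  ring

theorem rpow_norm_sub_lt {a : ℝ} (ha : 0 < a) {w y : EuclideanSpace ℝ (Fin d)} (hne : w - y ≠ 0)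
    (h : 0 < inner ℝ w y) : ‖w + y‖ ^ (-a) < ‖w - y‖ ^ (-a) := by
  refine Real.rpow_lt_rpow_of_neg (norm_pos_iff.2 hne) ?_ (by linarith)
  refine lt_of_pow_lt_pow_left₀ 2 (norm_nonneg _) ?_
  rw [norm_add_sq_real, norm_sub_sq_real]
  linarith

theorem inner_evenKernelProd_nonneg {a : ℝ} (ha : 0 < a) (b : ℝ)
    {w y : EuclideanSpace ℝ (Fin d)} (h1 : w - y ≠ 0) (h2 : w + y ≠ 0) :
    0 ≤ inner ℝ w (evenKernelProd a b w y) := by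
  rw [inner_evenKernelProd]
  refine mul_nonneg (by positivity) ?_
  rcases lt_trichotomy (inner ℝ w y) 0 with h | h | h
  · have := rpow_norm_sub_lt ha (w := w) (y := -y) (by simpa using h2)
      (by rw [inner_neg_right]; linarith)
    rw [sub_neg_eq_add, ← sub_eq_add_neg] at this
    exact mul_nonneg_of_nonpos_of_nonpos (by linarith) h.le
  · simp [h]
  · have := rpow_norm_sub_lt ha h1 h
    exact mul_nonneg (by linarith) h.le

/-- The difference `|w - y|^(-a) - |w + y|^(-a)` has the sign of `w · y`, so the integrand is
nonnegative almost everywhere. This makes the proportionality constant in `exists_kernelConv_eq`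
nonzero. -/
theorem inner_kernelConv_pos [NeZero d] {a b : ℝ} (ha0 : 0 < a) (ha : a < d) (hb1 : 1 ≤ b)
    (hb : b - 1 < d) (hab : d < a + b) {w : EuclideanSpace ℝ (Fin d)} (hw : w ≠ 0) :
    0 < inner ℝ w (kernelConv a b w) := by
  have hint := integrable_evenKernelProd ha0.le ha hb1 hb hab hw
  rw [kernelConv, ← integral_inner hint w, integral_pos_iff_support_of_nonneg_ae ?_
    (hint.const_inner w)]
  -- The open ball with diameter from `0` to `w` lies in the half-space `w · y > 0` and omits both
  -- singular points, so the integrand is strictly positive there.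
  · refine lt_of_lt_of_le (measure_ball_pos volume ((1 / 2 : ℝ) • w)
      (by positivity : 0 < ‖w‖ / 2)) (measure_mono fun y hy => ?_)
    rw [mem_ball_iff_norm] at hy
    have hwpos : 0 < ‖w‖ := norm_pos_iff.2 hw
    have h1 : 0 < inner ℝ w y := by
      have h2 : inner ℝ w y = ‖w‖ ^ 2 / 2 + inner ℝ w (y - (1 / 2 : ℝ) • w) := by
        rw [inner_sub_right, inner_smul_right, real_inner_self_eq_norm_sq]
        ring
      have h3 := neg_abs_le (inner ℝ w (y - (1 / 2 : ℝ) • w))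
      have h4 := abs_real_inner_le_norm w (y - (1 / 2 : ℝ) • w)
      have h5 := mul_lt_mul_of_pos_left hy hwpos
      rw [h2]
      nlinarith
    have hne : w - y ≠ 0 := by
      intro h
      rw [← sub_eq_zero.1 h, show w - (1 / 2 : ℝ) • w = (1 / 2 : ℝ) • w by module, norm_smul] at hy
      norm_num at hy
      linarith
    have hy0 : y ≠ 0 := by
      rintro rfl
      simp at h1
    have h6 := rpow_norm_sub_lt ha0 hne h1
    have h7 : 0 < ‖y‖ := norm_pos_iff.2 hy0
    rw [Function.mem_support, inner_evenKernelProd]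
    have : 0 < ‖w - y‖ ^ (-a) - ‖w + y‖ ^ (-a) := by linarith
    positivity
  · have h1 : ∀ᵐ y : EuclideanSpace ℝ (Fin d), y ≠ w := Measure.ae_ne volume w
    have h2 : ∀ᵐ y : EuclideanSpace ℝ (Fin d), y ≠ -w := Measure.ae_ne volume (-w)
    filter_upwards [h1, h2] with y h1 h2
    refine inner_evenKernelProd_nonneg ha0 b (sub_ne_zero.2 h1.symm) fun h => h2 ?_
    rw [eq_neg_iff_add_eq_zero, add_comm, h]

theorem exists_linearIsometryEquiv_map_eq {u v : EuclideanSpace ℝ (Fin d)} (h : ‖u‖ = ‖v‖) :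
    ∃ O : EuclideanSpace ℝ (Fin d) ≃ₗᵢ[ℝ] EuclideanSpace ℝ (Fin d), O u = v :=
  ⟨_, Submodule.reflection_sub h⟩

theorem exists_norm_eq_one [NeZero d] : ∃ e : EuclideanSpace ℝ (Fin d), ‖e‖ = 1 :=
  exists_norm_eq _ zero_le_one

/-- The convolution of the kernels is a positive multiple of the gradient of the fundamental
solution, by homogeneity and rotation invariance. -/
theorem exists_kernelConv_eq [NeZero d] {a b : ℝ} (ha0 : 0 < a) (ha : a < d) (hb1 : 1 ≤ b)
    (hab : a + b = 2 * d) (hb : b - 1 < d) :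
    ∃ κ : ℝ, 0 < κ ∧ ∀ w : EuclideanSpace ℝ (Fin d), w ≠ 0 →
      kernelConv a b w = κ • vecKernel d w := by
  have hd : (0 : ℝ) < d := by exact_mod_cast Nat.pos_of_ne_zero (NeZero.ne d)
  obtain ⟨e, he⟩ := exists_norm_eq_one (d := d)
  have he0 : e ≠ 0 := by
    rintro rfl
    simp at he
  have h1 : kernelConv a b e ∈ Submodule.span ℝ {e} := by
    -- The reflection across the line through `e` fixes `e`, hence by equivariance fixes the
    -- convolution at `e`, which must lie on that line.
    rw [← Submodule.reflection_eq_self_iff, ← kernelConv_map,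
      Submodule.reflection_mem_subspace_eq_self (Submodule.mem_span_singleton_self e)]
  obtain ⟨κ, hκ⟩ := Submodule.mem_span_singleton.1 h1
  refine ⟨κ, ?_, fun w hw => ?_⟩
  · have := inner_kernelConv_pos ha0 ha hb1 hb (by linarith) he0
    rwa [← hκ, inner_smul_right, real_inner_self_eq_norm_sq, he, one_pow, mul_one] at this
  · have hw0 : 0 < ‖w‖ := norm_pos_iff.2 hw
    have hu : ‖‖w‖⁻¹ • w‖ = 1 := by
      rw [norm_smul, norm_inv, norm_norm, inv_mul_cancel₀ hw0.ne']
    obtain ⟨O, hO⟩ := exists_linearIsometryEquiv_map_eq (he.trans hu.symm)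
    have h2 : w = ‖w‖ • O e := by
      rw [hO, smul_smul, mul_inv_cancel₀ hw0.ne', one_smul]
    have h3 : kernelConv a b w = ‖w‖ ^ (d + 1 - a - b) • O (kernelConv a b e) := by
      rw [← kernelConv_map, ← kernelConv_smul a b hw0, ← h2]
    rw [h3, ← hκ, map_smul, hO, vecKernel, smul_smul, smul_smul, smul_smul]
    congr 1
    rw [show (d : ℝ) + 1 - a - b = -d + 1 by linarith, Real.rpow_add_one hw0.ne']
    field_simp

/-- The same scaling and rotation argument applied to the absolute integral; it supplies the
majorant for the limit `R → ∞`. -/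
theorem exists_integral_norm_evenKernelProd_eq [NeZero d] {a b : ℝ} (hab : a + b = 2 * d) :
    ∃ κ : ℝ, 0 ≤ κ ∧ ∀ w : EuclideanSpace ℝ (Fin d), w ≠ 0 →
      ∫ y, ‖evenKernelProd a b w y‖ = κ * ‖w‖ ^ (-((d : ℝ) - 1)) := by
  obtain ⟨e, he⟩ := exists_norm_eq_one (d := d)
  refine ⟨∫ y, ‖evenKernelProd a b e y‖, integral_nonneg fun _ => norm_nonneg _, fun w hw => ?_⟩
  have hw0 : 0 < ‖w‖ := norm_pos_iff.2 hw
  have hu : ‖‖w‖⁻¹ • w‖ = 1 := by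
    rw [norm_smul, norm_inv, norm_norm, inv_mul_cancel₀ hw0.ne']
  obtain ⟨O, hO⟩ := exists_linearIsometryEquiv_map_eq (he.trans hu.symm)
  have h2 : w = ‖w‖ • O e := by
    rw [hO, smul_smul, mul_inv_cancel₀ hw0.ne', one_smul]
  calc ∫ y, ‖evenKernelProd a b w y‖ = ∫ y, ‖evenKernelProd a b (‖w‖ • O e) y‖ := by rw [← h2]
    _ = _ := by
      rw [integral_norm_evenKernelProd_smul a b hw0, integral_norm_evenKernelProd_map, mul_comm]
      congr 2
      linarith

end ConvolutionOfKernels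

/-! ### Recovering a function from the gradient of its potential -/

section Representation

variable {d : ℕ}

/-- The convolution of `φ` with `|·|^(-a)`. -/
noncomputable def powerPotential (a : ℝ) (φ : EuclideanSpace ℝ (Fin d) → ℝ)
    (x : EuclideanSpace ℝ (Fin d)) : ℝ :=
  ∫ y, φ y * ‖x - y‖ ^ (-a)

theorem powerPotential_eq_convolution (a : ℝ) (φ : EuclideanSpace ℝ (Fin d) → ℝ) :
    powerPotential a φ =
      convolution φ (fun y => ‖y‖ ^ (-a)) (ContinuousLinearMap.lsmul ℝ ℝ) volume := by
  ext x
  simp [powerPotential, convolution_def]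

theorem contDiff_powerPotential [NeZero d] {a : ℝ} (ha : a < d)
    {φ : EuclideanSpace ℝ (Fin d) → ℝ} (hφ : ContDiff ℝ 1 φ) (hc : HasCompactSupport φ) :
    ContDiff ℝ 1 (powerPotential a φ) := by
  rw [powerPotential_eq_convolution]
  exact hc.contDiff_convolution_left (n := 1) _ hφ (locallyIntegrable_norm_rpow ha)

theorem integrable_rpow_norm_sub_smul [NeZero d] {a : ℝ} (ha : a < d) {F : Type*}
    [NormedAddCommGroup F] [NormedSpace ℝ F] {g : EuclideanSpace ℝ (Fin d) → F}
    (hg : Continuous g) (hgc : HasCompactSupport g) (x : EuclideanSpace ℝ (Fin d)) :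
    Integrable fun z => ‖x - z‖ ^ (-a) • g z :=
  hgc.convolutionExists_left (ContinuousLinearMap.lsmul ℝ ℝ).flip hg
    (locallyIntegrable_norm_rpow ha) x

theorem fderiv_convolution_apply [NeZero d] {k : EuclideanSpace ℝ (Fin d) → ℝ}
    (hk : LocallyIntegrable k)
    {φ : EuclideanSpace ℝ (Fin d) → ℝ} (hφ : ContDiff ℝ 1 φ) (hc : HasCompactSupport φ)
    (x v : EuclideanSpace ℝ (Fin d)) :
    fderiv ℝ (convolution φ k (ContinuousLinearMap.lsmul ℝ ℝ) volume) x v =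
      ∫ z, k (x - z) * fderiv ℝ φ z v := by
  have h1 := (hc.hasFDerivAt_convolution_left (ContinuousLinearMap.lsmul ℝ ℝ) hφ
    hk x).fderiv
  rw [h1, convolution_def, ContinuousLinearMap.integral_apply]
  · refine integral_congr_ae (Eventually.of_forall fun z => ?_)
    simp only [ContinuousLinearMap.precompL_apply]
    simp [mul_comm]
  · exact (hc.fderiv (𝕜 := ℝ)).convolutionExists_left _
      (hφ.continuous_fderiv one_ne_zero) hk x

theorem gradient_powerPotential [NeZero d] {a : ℝ} (ha : a < d)
    {φ : EuclideanSpace ℝ (Fin d) → ℝ} (hφ : ContDiff ℝ 1 φ) (hc : HasCompactSupport φ)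
    (x : EuclideanSpace ℝ (Fin d)) :
    ∇ (powerPotential a φ) x = ∫ z, ‖x - z‖ ^ (-a) • ∇ φ z := by
  refine ext_inner_right ℝ fun v => ?_
  have h0 : fderiv ℝ (powerPotential a φ) x v = ∫ z, ‖x - z‖ ^ (-a) * fderiv ℝ φ z v := by
    rw [powerPotential_eq_convolution,
      fderiv_convolution_apply (locallyIntegrable_norm_rpow ha) hφ hc]
  have hint := integrable_rpow_norm_sub_smul ha (continuous_gradient hφ) hc.gradient x
  rw [inner_gradient_left, h0, real_inner_comm, ← integral_inner hint]
  refine integral_congr_ae (Eventually.of_forall fun z => ?_)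
  simp only [inner_smul_right]
  rw [real_inner_comm, inner_gradient_left]

/-- The hypothesis of Fubini's theorem. With `y` in a ball and `x - w` in the support of `g`, the
difference `w - y` stays bounded, so both kernels may be truncated and the integrand is dominated by
that of a convolution of two `L^1` functions. -/
theorem integrable_prod_inner_kernelProd [NeZero d] {a b : ℝ} (ha : a < d) (hb : b - 1 < d)
    {g : EuclideanSpace ℝ (Fin d) → EuclideanSpace ℝ (Fin d)} (hg : Continuous g)
    (hgc : HasCompactSupport g) (x : EuclideanSpace ℝ (Fin d)) (R : ℝ) :
    Integrable (Function.uncurry fun w y => inner ℝ (kernelProd a b w y) (g (x - w)))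
      (volume.prod (volume.restrict (ball 0 R))) := by
  obtain ⟨M, hM⟩ := hg.bounded_above_of_compact_support hgc
  obtain ⟨ρ, hρ⟩ := hgc.isCompact.isBounded.subset_ball 0
  set T := ‖x‖ + ρ + R with hT
  have h1 : IntegrableOn (vecKernel b : EuclideanSpace ℝ (Fin d) → _) (ball 0 R) :=
    ((locallyIntegrable_vecKernel hb).integrableOn_isCompact
      (isCompact_closedBall 0 R)).mono_set ball_subset_closedBall
  have h2 : Integrable ((ball 0 T).indicator fun y : EuclideanSpace ℝ (Fin d) => ‖y‖ ^ (-a)) :=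
    (integrable_indicator_iff measurableSet_ball).2 (integrableOn_ball_norm_rpow ha T)
  have h3 := Integrable.convolution_integrand (ContinuousLinearMap.lsmul ℝ ℝ).flip h1 h2
  refine (h3.norm.const_mul M).mono' ?_ ?_
  · have : Measurable fun z : EuclideanSpace ℝ (Fin d) × EuclideanSpace ℝ (Fin d) =>
        inner ℝ (kernelProd a b z.1 z.2) (g (x - z.1)) :=
      (measurable_kernelProd a b).inner (hg.measurable.comp (measurable_const.sub measurable_fst))
    exact this.aestronglyMeasurable
  · have hprod := Measure.prod_restrict (μ := (volume : Measure (EuclideanSpace ℝ (Fin d))))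
      (ν := (volume : Measure (EuclideanSpace ℝ (Fin d)))) univ (ball 0 R)
    rw [Measure.restrict_univ] at hprod
    rw [hprod]
    filter_upwards [ae_restrict_mem (MeasurableSet.univ.prod measurableSet_ball)] with z hz
    have hz2 : ‖z.2‖ < R := by simpa using hz.2
    by_cases hw : g (x - z.1) = 0
    · simp only [Function.uncurry, hw, inner_zero_right, norm_zero]
      exact mul_nonneg ((norm_nonneg _).trans (hM 0)) (norm_nonneg _)
    · have h4 : ‖x - z.1‖ < ρ := by
        simpa using hρ (subset_tsupport g hw)
      have h5 : z.1 - z.2 ∈ ball (0 : EuclideanSpace ℝ (Fin d)) T := by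
        have h6 := norm_sub_le z.1 z.2
        have h7 := norm_sub_le x (x - z.1)
        rw [sub_sub_cancel] at h7
        rw [mem_ball_zero_iff]
        linarith
      simp only [ContinuousLinearMap.flip_apply, ContinuousLinearMap.lsmul_apply,
        indicator_of_mem h5]
      refine (norm_inner_le_norm _ _).trans ?_
      rw [mul_comm, kernelProd]
      exact mul_le_mul_of_nonneg_right (hM _) (norm_nonneg _)

/-- The derivative falls on `φ`, and Fubini then groups the two kernels together. The truncation to
a ball is needed because the full double integral may fail to converge absolutely. -/
theorem setIntegral_inner_gradient_powerPotential [NeZero d] {a b : ℝ} (ha0 : 0 ≤ a) (ha : a < d)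
    (hb1 : 1 ≤ b) (hb : b - 1 < d) {φ : EuclideanSpace ℝ (Fin d) → ℝ} (hφ : ContDiff ℝ 1 φ)
    (hc : HasCompactSupport φ) (x : EuclideanSpace ℝ (Fin d)) (R : ℝ) :
    ∫ y in ball 0 R, inner ℝ (vecKernel b y) (∇ (powerPotential a φ) (x - y)) =
      ∫ w, inner ℝ (∫ y in ball 0 R, evenKernelProd a b w y) (∇ φ (x - w)) := by
  have hg := continuous_gradient hφ
  have hgc := hc.gradient
  have h1 : ∀ y, inner ℝ (vecKernel b y) (∇ (powerPotential a φ) (x - y)) =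
      ∫ w, inner ℝ (kernelProd a b w y) (∇ φ (x - w)) := by
    intro y
    rw [gradient_powerPotential ha hφ hc,
      ← integral_inner (integrable_rpow_norm_sub_smul ha hg hgc (x - y)),
      ← integral_sub_left_eq_self _ volume x]
    refine integral_congr_ae (Eventually.of_forall fun w => ?_)
    simp only [kernelProd, inner_smul_left, inner_smul_right, conj_trivial]
    rw [show x - y - (x - w) = w - y by abel]
  simp only [h1]
  rw [← integral_integral_swap (integrable_prod_inner_kernelProd ha hb hg hgc x R)]
  refine integral_congr_ae ?_
  filter_upwards [Measure.ae_ne volume (0 : EuclideanSpace ℝ (Fin d))] with w hw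
  rw [setIntegral_evenKernelProd ha0 ha hb1 hb hw, real_inner_comm,
    ← integral_inner (integrableOn_kernelProd ha0 ha hb1 hb hw R)]
  simp only [real_inner_comm]

/-- After the exchange of integrals, dominated convergence replaces the truncated kernel convolution
by `κ |w|^(-d) w`, and the classical representation gives `A = κ * sphereArea d`. -/
theorem tendsto_setIntegral_inner_gradient_powerPotential [NeZero d] {a b : ℝ} (ha0 : 0 < a)
    (ha : a < d) (hb1 : 1 ≤ b) (hab : a + b = 2 * d) (hb : b - 1 < d) :
    ∃ A : ℝ, 0 < A ∧ ∀ φ : EuclideanSpace ℝ (Fin d) → ℝ, ContDiff ℝ 1 φ →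
      HasCompactSupport φ → ∀ x, Tendsto (fun R : ℝ => ∫ y in ball 0 R,
        inner ℝ (vecKernel b y) (∇ (powerPotential a φ) (x - y))) atTop (𝓝 (A * φ x)) := by
  obtain ⟨κ, hκ, hK⟩ := exists_kernelConv_eq ha0 ha hb1 hab hb
  obtain ⟨κ', hκ', hK'⟩ := exists_integral_norm_evenKernelProd_eq (a := a) (b := b) hab
  have hd : (0 : ℝ) < d := by exact_mod_cast Nat.pos_of_ne_zero (NeZero.ne d)
  refine ⟨κ * sphereArea d, mul_pos hκ (sphereArea_pos d), fun φ hφ hc x => ?_⟩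
  have hg := continuous_gradient hφ
  have hgc := hc.gradient
  have h0 : ∀ᵐ w : EuclideanSpace ℝ (Fin d), w ≠ 0 := Measure.ae_ne volume 0
  have hlim : ∫ w, inner ℝ (kernelConv a b w) (∇ φ (x - w)) = κ * sphereArea d * φ x := by
    rw [mul_assoc, ← integral_inner_vecKernel_gradient hφ hc x, ← integral_const_mul]
    refine integral_congr_ae ?_
    filter_upwards [h0] with w hw
    rw [hK w hw, inner_smul_left, conj_trivial]
  simp only [setIntegral_inner_gradient_powerPotential ha0.le ha hb1 hb hφ hc x]
  rw [← hlim]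
  have hbound : Integrable fun w => κ' * ‖‖w‖ ^ (-((d : ℝ) - 1)) • ∇ φ (x - w)‖ := by
    refine Integrable.const_mul (Integrable.norm ?_) κ'
    exact hgc.convolutionExists_right (ContinuousLinearMap.lsmul ℝ ℝ)
      (locallyIntegrable_norm_rpow (by linarith)) hg x
  refine tendsto_integral_filter_of_dominated_convergence _ (Eventually.of_forall fun R => ?_)
    (Eventually.of_forall fun R => ?_) hbound ?_
  · have h1 := (integrable_prod_inner_kernelProd ha hb hg hgc x R).integral_prod_left
    refine h1.aestronglyMeasurable.congr ?_
    filter_upwards [h0] with w hw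
    rw [setIntegral_evenKernelProd ha0.le ha hb1 hb hw, real_inner_comm,
      ← integral_inner (integrableOn_kernelProd ha0.le ha hb1 hb hw R)]
    simp only [Function.uncurry, real_inner_comm]
  · filter_upwards [h0] with w hw
    refine (norm_inner_le_norm _ _).trans ?_
    rw [norm_smul, ← mul_assoc, Real.norm_of_nonneg (by positivity), ← hK' w hw]
    refine mul_le_mul_of_nonneg_right ((norm_integral_le_integral_norm _).trans ?_)
      (norm_nonneg _)
    exact setIntegral_le_integral
      (integrable_evenKernelProd ha0.le ha hb1 hb (by linarith) hw).norm
      (Eventually.of_forall fun _ => norm_nonneg _)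
  · filter_upwards [h0] with w hw
    have h1 := (aecover_ball (μ := volume) (x := (0 : EuclideanSpace ℝ (Fin d)))
      (tendsto_id (α := ℝ))).integral_tendsto_of_countably_generated
      (integrable_evenKernelProd ha0.le ha hb1 hb (by linarith) hw)
    exact h1.inner tendsto_const_nhds

/-- Decay of the gradient of the potential away from the support. -/
theorem norm_gradient_powerPotential_le [NeZero d] {a : ℝ} (ha0 : 0 ≤ a) (ha : a < d)
    {φ : EuclideanSpace ℝ (Fin d) → ℝ} (hφ : Continuous φ) (hc : HasCompactSupport φ)
    {x : EuclideanSpace ℝ (Fin d)} {ρ : ℝ} (hρ : 0 < ρ) (hx : ∀ z, φ z ≠ 0 → ρ ≤ ‖x - z‖) :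
    ‖∇ (powerPotential a φ) x‖ ≤ a * (ρ / 2) ^ (-a - 1) * ∫ z, ‖φ z‖ := by
  have hL1 : Integrable φ := hφ.integrable_of_hasCompactSupport hc
  have hint : ∀ y, Integrable fun z => φ z * ‖y - z‖ ^ (-a) := fun y =>
    (integrable_rpow_norm_sub_smul ha hφ hc y).congr
      (Eventually.of_forall fun z => by simp [mul_comm])
  have h0 : 0 ≤ ∫ z, ‖φ z‖ := integral_nonneg fun _ => norm_nonneg _
  rw [gradient, LinearIsometryEquiv.norm_map]
  -- A local Lipschitz constant bounds the derivative. Points within `ρ/2` of `x` stay at distance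
  -- at least `ρ/2` from the points where `φ` is nonzero, so the kernel is Lipschitz in the relevant
  -- range.
  refine norm_fderiv_le_of_lip' ℝ (by positivity) ?_
  filter_upwards [ball_mem_nhds x (half_pos hρ)] with y hy
  rw [mem_ball_iff_norm] at hy
  rw [powerPotential, powerPotential, ← integral_sub (hint y) (hint x)]
  calc ‖∫ z, (φ z * ‖y - z‖ ^ (-a) - φ z * ‖x - z‖ ^ (-a))‖
      ≤ ∫ z, (a * (ρ / 2) ^ (-a - 1) * ‖y - x‖) * ‖φ z‖ := by
        refine norm_integral_le_of_norm_le (hL1.norm.const_mul _)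
          (Eventually.of_forall fun z => ?_)
        rw [← mul_sub, norm_mul, mul_comm]
        rcases eq_or_ne (φ z) 0 with hz | hz
        · simp [hz]
        · refine mul_le_mul_of_nonneg_right ?_ (norm_nonneg _)
          have h1 := hx z hz
          have h2 : ρ / 2 ≤ ‖y - z‖ := by
            have := norm_sub_le_norm_sub_add_norm_sub x y z
            rw [norm_sub_rev x y] at this
            linarith
          have := abs_norm_rpow_neg_sub_le ha0 (half_pos hρ) h2 (by linarith : ρ / 2 ≤ ‖x - z‖)
          rwa [show y - z - (x - z) = y - x by abel] at this
    _ = _ := by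
        rw [integral_const_mul]
        ring

end Representation

/-! ### Linearity of the fractional gradient and pointwise bounds by it -/

section FracGradient

variable {d : ℕ}

theorem gradient_const_mul_apply {φ : EuclideanSpace ℝ (Fin d) → ℝ} (c : ℝ)
    {x : EuclideanSpace ℝ (Fin d)} (h : DifferentiableAt ℝ φ x) :
    ∇ (fun y => c * φ y) x = c • ∇ φ x := by
  refine ext_inner_right ℝ fun v => ?_
  rw [inner_gradient_left, inner_smul_left, inner_gradient_left, fderiv_const_mul h]
  simp

theorem gradient_add_apply {φ ψ : EuclideanSpace ℝ (Fin d) → ℝ} {x : EuclideanSpace ℝ (Fin d)}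
    (hφ : DifferentiableAt ℝ φ x) (hψ : DifferentiableAt ℝ ψ x) :
    ∇ (fun y => φ y + ψ y) x = ∇ φ x + ∇ ψ x := by
  refine ext_inner_right ℝ fun v => ?_
  rw [inner_gradient_left, inner_add_left, inner_gradient_left, inner_gradient_left,
    fderiv_fun_add hφ hψ]
  simp

/-- Only the positivity of the normalizing constant matters from here on. -/
theorem exists_rieszPotential_eq [NeZero d] {s : ℝ} (hs0 : 0 < s) (hs1 : s < 1) :
    ∃ c : ℝ, 0 < c ∧ ∀ φ : EuclideanSpace ℝ (Fin d) → ℝ,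
      rieszPotential s φ = fun x => c * powerPotential (d + s - 1) φ x := by
  have hd : (1 : ℝ) ≤ d := by exact_mod_cast NeZero.one_le
  refine ⟨(2 ^ s * Real.Gamma ((d + s + 1) / 2)) /
      (Real.pi ^ ((d : ℝ) / 2) * (d - 1 + s) * Real.Gamma ((1 - s) / 2)), ?_, fun φ => ?_⟩
  · have h1 := Real.Gamma_pos_of_pos (by linarith : 0 < ((d : ℝ) + s + 1) / 2)
    have h2 := Real.Gamma_pos_of_pos (by linarith : 0 < (1 - s) / 2)
    have h3 : 0 < (d : ℝ) - 1 + s := by linarith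
    have := Real.pi_pos
    positivity
  · ext x
    rw [rieszPotential, powerPotential]
    congr 1
    refine integral_congr_ae (Eventually.of_forall fun y => ?_)
    simp only
    rw [Real.rpow_neg (norm_nonneg _), div_eq_mul_inv]

theorem exists_fracGradient_eq [NeZero d] {s : ℝ} (hs0 : 0 < s) (hs1 : s < 1) :
    ∃ c : ℝ, 0 < c ∧ ∀ φ : EuclideanSpace ℝ (Fin d) → ℝ, ContDiff ℝ 1 φ →
      HasCompactSupport φ → ∀ x,
      fracGradient s φ x = c • ∇ (powerPotential (d + s - 1) φ) x := by
  obtain ⟨c, hc, h⟩ := exists_rieszPotential_eq (d := d) hs0 hs1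
  refine ⟨c, hc, fun φ hφ hφc x => ?_⟩
  rw [fracGradient, if_neg hs1.ne, h φ]
  exact gradient_const_mul_apply c
    ((contDiff_powerPotential (by linarith) hφ hφc).differentiable one_ne_zero x)

theorem continuous_fracGradient [NeZero d] {s : ℝ} (hs0 : 0 < s) (hs1 : s ≤ 1)
    {φ : EuclideanSpace ℝ (Fin d) → ℝ} (hφ : ContDiff ℝ 1 φ) (hc : HasCompactSupport φ) :
    Continuous (fracGradient s φ) := by
  rcases hs1.eq_or_lt with rfl | hs1
  · rw [fracGradient, if_pos rfl]
    exact continuous_gradient hφ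
  · obtain ⟨c, -, h⟩ := exists_fracGradient_eq (d := d) hs0 hs1
    rw [funext (h φ hφ hc)]
    exact (continuous_gradient (contDiff_powerPotential (by linarith) hφ hc)).const_smul c

theorem powerPotential_add [NeZero d] {a : ℝ} (ha : a < d) {φ ψ : EuclideanSpace ℝ (Fin d) → ℝ}
    (hφ : Continuous φ) (hφc : HasCompactSupport φ) (hψ : Continuous ψ)
    (hψc : HasCompactSupport ψ) :
    powerPotential a (φ + ψ) = fun x => powerPotential a φ x + powerPotential a ψ x := by
  ext x
  have hint : ∀ χ : EuclideanSpace ℝ (Fin d) → ℝ, Continuous χ → HasCompactSupport χ →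
      Integrable fun z => χ z * ‖x - z‖ ^ (-a) := fun χ hχ hχc =>
    (integrable_rpow_norm_sub_smul ha hχ hχc x).congr
      (Eventually.of_forall fun z => by simp [mul_comm])
  simp only [powerPotential]
  rw [← integral_add (hint φ hφ hφc) (hint ψ hψ hψc)]
  simp only [Pi.add_apply, add_mul]

theorem powerPotential_smul (a c : ℝ) (φ : EuclideanSpace ℝ (Fin d) → ℝ) :
    powerPotential a (c • φ) = fun x => c * powerPotential a φ x := by
  ext x
  simp only [powerPotential, ← integral_const_mul, Pi.smul_apply, smul_eq_mul, mul_assoc]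

theorem fracGradient_add [NeZero d] {s : ℝ} (hs0 : 0 < s) (hs1 : s ≤ 1)
    {φ ψ : EuclideanSpace ℝ (Fin d) → ℝ} (hφ : ContDiff ℝ 1 φ) (hφc : HasCompactSupport φ)
    (hψ : ContDiff ℝ 1 ψ) (hψc : HasCompactSupport ψ) (x : EuclideanSpace ℝ (Fin d)) :
    fracGradient s (φ + ψ) x = fracGradient s φ x + fracGradient s ψ x := by
  rcases hs1.eq_or_lt with rfl | hs1
  · simp only [fracGradient, if_pos]
    exact gradient_add_apply (hφ.differentiable one_ne_zero x) (hψ.differentiable one_ne_zero x)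
  · obtain ⟨c, -, h⟩ := exists_fracGradient_eq (d := d) hs0 hs1
    have ha : (d : ℝ) + s - 1 < d := by linarith
    rw [h (φ + ψ) (hφ.add hψ) (hφc.add hψc), h φ hφ hφc, h ψ hψ hψc, ← smul_add,
      powerPotential_add ha hφ.continuous hφc hψ.continuous hψc,
      gradient_add_apply ((contDiff_powerPotential ha hφ hφc).differentiable one_ne_zero x)
        ((contDiff_powerPotential ha hψ hψc).differentiable one_ne_zero x)]

theorem fracGradient_smul [NeZero d] {s : ℝ} (hs0 : 0 < s) (hs1 : s ≤ 1) (c : ℝ)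
    {φ : EuclideanSpace ℝ (Fin d) → ℝ} (hφ : ContDiff ℝ 1 φ) (hφc : HasCompactSupport φ)
    (x : EuclideanSpace ℝ (Fin d)) :
    fracGradient s (c • φ) x = c • fracGradient s φ x := by
  rcases hs1.eq_or_lt with rfl | hs1
  · simp only [fracGradient, if_pos]
    exact gradient_const_mul_apply c (hφ.differentiable one_ne_zero x)
  · obtain ⟨k, -, h⟩ := exists_fracGradient_eq (d := d) hs0 hs1
    have ha : (d : ℝ) + s - 1 < d := by linarith
    rw [h (c • φ) (contDiff_const.smul hφ) hφc.smul_left, h φ hφ hφc, smul_comm c k,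
      powerPotential_smul, gradient_const_mul_apply c
        ((contDiff_powerPotential ha hφ hφc).differentiable one_ne_zero x)]

theorem tendsto_setIntegral_compl_ball {b : ℝ} (hb : (d : ℝ) < b) :
    Tendsto (fun n : ℕ => ∫ y : EuclideanSpace ℝ (Fin d) in (ball 0 ((n : ℝ) + 1))ᶜ,
      ‖y‖ ^ (-b)) atTop (𝓝 0) := by
  have h := Antitone.tendsto_setIntegral (μ := volume)
    (s := fun n : ℕ => (ball (0 : EuclideanSpace ℝ (Fin d)) ((n : ℝ) + 1))ᶜ)
    (f := fun y => ‖y‖ ^ (-b)) (fun _ => measurableSet_ball.compl) ?_ ?_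
  · have he : ⋂ n : ℕ, (ball (0 : EuclideanSpace ℝ (Fin d)) ((n : ℝ) + 1))ᶜ = ∅ := by
      refine eq_empty_of_forall_notMem fun y hy => ?_
      obtain ⟨n, hn⟩ := exists_nat_gt ‖y‖
      have := mem_iInter.1 hy n
      simp only [mem_compl_iff, mem_ball_zero_iff, not_lt] at this
      linarith
    rwa [he, Measure.restrict_empty, integral_zero_measure] at h
  · intro m n hmn
    refine compl_subset_compl.2 (ball_subset_ball ?_)
    have : (m : ℝ) ≤ n := by exact_mod_cast hmn
    linarith
  · exact integrableOn_compl_ball_norm_rpow hb (by positivity)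

theorem integrableOn_rpow_mul_norm_comp_sub [NeZero d] {b : ℝ} (hb : b < d) {F : Type*}
    [NormedAddCommGroup F] {g : EuclideanSpace ℝ (Fin d) → F} (hg : Continuous g)
    (x : EuclideanSpace ℝ (Fin d)) (R : ℝ) :
    IntegrableOn (fun y => ‖y‖ ^ (-b) * ‖g (x - y)‖) (ball 0 R) := by
  have h := (locallyIntegrable_norm_rpow hb).integrableOn_isCompact
    (isCompact_closedBall (0 : EuclideanSpace ℝ (Fin d)) R)
  have hc : ContinuousOn (fun y => ‖g (x - y)‖) (closedBall 0 R) :=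
    (hg.comp (continuous_const.sub continuous_id)).norm.continuousOn
  exact (h.mul_continuousOn hc (isCompact_closedBall 0 R)).mono_set ball_subset_closedBall

theorem norm_inner_vecKernel_le (b : ℝ) (y g : EuclideanSpace ℝ (Fin d)) :
    ‖(inner ℝ (vecKernel b y) g : ℝ)‖ ≤ ‖y‖ ^ (-(b - 1)) * ‖g‖ :=
  (norm_inner_le_norm _ _).trans
    (mul_le_mul_of_nonneg_right (norm_vecKernel_le b y) (norm_nonneg _))

/-- For `s = 1` the gradient is local: with `φ` supported in the closed ball of radius `B` and `|x|
< B`, the integrand vanishes once `|y| ≥ 2B`, so there is no tail. -/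
theorem exists_abs_le_setIntegral_gradient [NeZero d] (B : ℝ) :
    ∃ R : ℝ, ∀ φ : EuclideanSpace ℝ (Fin d) → ℝ, ContDiff ℝ 1 φ → HasCompactSupport φ →
      (∀ z, φ z ≠ 0 → ‖z‖ < B) → ∀ x, ‖x‖ < B →
      sphereArea d * |φ x| ≤ ∫ y in ball 0 R, ‖y‖ ^ (-((d : ℝ) - 1)) * ‖∇ φ (x - y)‖ := by
  refine ⟨2 * B, fun φ hφ hc hφB x hx => ?_⟩
  have h1 : ∀ y, y ∉ ball (0 : EuclideanSpace ℝ (Fin d)) (2 * B) →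
      inner ℝ (vecKernel d y) (∇ φ (x - y)) = 0 := by
    intro y hy
    have h2 : x - y ∉ tsupport φ := by
      intro h
      have h3 : tsupport φ ⊆ closedBall 0 B :=
        closure_minimal (fun z hz => by simpa using (hφB z hz).le) isClosed_closedBall
      have h4 : ‖x - y‖ ≤ B := by simpa using h3 h
      have h5 : 2 * B ≤ ‖y‖ := by simpa using hy
      have h6 := norm_sub_le x (x - y)
      rw [sub_sub_cancel] at h6
      linarith
    have h7 : ∇ φ (x - y) = 0 := by
      have : fderiv ℝ φ (x - y) = 0 :=
        Function.notMem_support.1 fun h => h2 (support_fderiv_subset ℝ h)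
      rw [gradient, this, map_zero]
    rw [h7, inner_zero_right]
  rw [← abs_of_pos (sphereArea_pos d), ← abs_mul, ← integral_inner_vecKernel_gradient hφ hc x,
    ← setIntegral_eq_integral_of_forall_compl_eq_zero h1, ← Real.norm_eq_abs]
  refine norm_integral_le_of_norm_le (integrableOn_rpow_mul_norm_comp_sub (by linarith)
    (continuous_gradient hφ) x _) (Eventually.of_forall fun y => ?_)
  exact norm_inner_vecKernel_le d y _

/-- The gradient of the potential decays like `|y|^(-a-1)` times `‖φ‖_1`, so the integrand of the
representation formula has a tail of order `|y|^(-2d)`. A large `R` therefore costs only `η ‖φ‖_1`,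
uniformly in `φ` and `x`. -/
theorem exists_abs_le_setIntegral_gradient_powerPotential [NeZero d] {a b : ℝ} (ha0 : 0 < a)
    (ha : a < d) (hb1 : 1 ≤ b) (hab : a + b = 2 * d) (hb : b - 1 < d) :
    ∃ A : ℝ, 0 < A ∧ ∀ B η : ℝ, 0 < B → 0 < η → ∃ R : ℝ,
      ∀ φ : EuclideanSpace ℝ (Fin d) → ℝ, ContDiff ℝ 1 φ → HasCompactSupport φ →
      (∀ z, φ z ≠ 0 → ‖z‖ < B) → ∀ x, ‖x‖ < B →
      A * |φ x| ≤ (∫ y in ball 0 R, ‖y‖ ^ (-(b - 1)) * ‖∇ (powerPotential a φ) (x - y)‖) +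
        η * ∫ z, ‖φ z‖ := by
  obtain ⟨A, hA, hlim⟩ := tendsto_setIntegral_inner_gradient_powerPotential ha0 ha hb1 hab hb
  have hd : (0 : ℝ) < d := by exact_mod_cast Nat.pos_of_ne_zero (NeZero.ne d)
  refine ⟨A, hA, fun B η hB hη => ?_⟩
  set C := a * (1 / 4 : ℝ) ^ (-a - 1) with hC
  have hC0 : 0 < C := by positivity
  -- For `|y| ≥ 4B` the point `x - y` is at distance at least `|y|/2` from the points where `φ` is
  -- nonzero. The gradient bound halves this again, whence the `1/4` in `C`.
  obtain ⟨n, hn, hn2⟩ : ∃ n : ℕ, C * ∫ y : EuclideanSpace ℝ (Fin d) in (ball 0 ((n : ℝ) + 1))ᶜ,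
      ‖y‖ ^ (-(2 * d : ℝ)) < η ∧ 4 * B ≤ (n : ℝ) + 1 := by
    have h1 := (tendsto_setIntegral_compl_ball (d := d) (b := 2 * d) (by linarith)).const_mul C
    rw [mul_zero] at h1
    obtain ⟨m, hm⟩ := exists_nat_ge (4 * B)
    obtain ⟨n, h2, h3⟩ := ((h1.eventually_lt_const hη).and (eventually_ge_atTop m)).exists
    refine ⟨n, ?_, ?_⟩
    · simpa [mul_comm] using h2
    · have : (m : ℝ) ≤ n := by exact_mod_cast h3
      linarith
  refine ⟨n + 1, fun φ hφ hc hφB x hx => ?_⟩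
  set R : ℝ := n + 1 with hR
  have hR0 : 0 < R := by positivity
  set G := ∇ (powerPotential a φ) with hG
  have hGc : Continuous G := continuous_gradient (contDiff_powerPotential ha hφ hc)
  set M := ∫ z, ‖φ z‖ with hM
  have hM0 : 0 ≤ M := integral_nonneg fun _ => norm_nonneg _
  have hfar : ∀ y, y ∉ ball (0 : EuclideanSpace ℝ (Fin d)) R →
      ‖y‖ ^ (-(b - 1)) * ‖G (x - y)‖ ≤ C * M * ‖y‖ ^ (-(2 * d : ℝ)) := by
    intro y hy
    have hy : R ≤ ‖y‖ := by simpa using hy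
    have hy0 : 0 < ‖y‖ := by linarith
    have h1 : ‖G (x - y)‖ ≤ a * (‖y‖ / 2 / 2) ^ (-a - 1) * M := by
      refine norm_gradient_powerPotential_le ha0.le ha hφ.continuous hc (half_pos hy0)
        fun z hz => ?_
      have h2 := hφB z hz
      have h3 := norm_sub_norm_le y (x - z)
      rw [← norm_neg (y - (x - z)), show -(y - (x - z)) = x - y - z by abel] at h3
      have h4 := norm_sub_le x z
      linarith
    calc ‖y‖ ^ (-(b - 1)) * ‖G (x - y)‖
        ≤ ‖y‖ ^ (-(b - 1)) * (a * (‖y‖ / 2 / 2) ^ (-a - 1) * M) := by gcongr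
      _ = C * M * (‖y‖ ^ (-(b - 1)) * ‖y‖ ^ (-a - 1)) := by
          rw [show ‖y‖ / 2 / 2 = 1 / 4 * ‖y‖ by ring, Real.mul_rpow (by norm_num) hy0.le, hC]
          ring
      _ = C * M * ‖y‖ ^ (-(2 * d : ℝ)) := by
          rw [← Real.rpow_add hy0, ← hab]
          ring_nf
  set Q : EuclideanSpace ℝ (Fin d) → ℝ := fun y =>
    (ball 0 R).indicator (fun y => ‖y‖ ^ (-(b - 1)) * ‖G (x - y)‖) y +
      (ball 0 R)ᶜ.indicator (fun y => C * M * ‖y‖ ^ (-(2 * d : ℝ))) y with hQ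
  have hQ1 := (integrable_indicator_iff measurableSet_ball).2
    (integrableOn_rpow_mul_norm_comp_sub hb hGc x R)
  have hQ2 := (integrable_indicator_iff measurableSet_ball.compl).2
    ((integrableOn_compl_ball_norm_rpow (d := d) (b := 2 * d) (by linarith) hR0).const_mul (C * M))
  have hQi : Integrable Q := hQ1.add hQ2
  have hQ0 : ∀ y, ‖(inner ℝ (vecKernel b y) (G (x - y)) : ℝ)‖ ≤ Q y := by
    intro y
    refine (norm_inner_vecKernel_le b y _).trans ?_
    by_cases hy : y ∈ ball (0 : EuclideanSpace ℝ (Fin d)) R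
    · simp [hQ, hy]
    · have := hfar y hy
      simpa [hQ, hy] using this
  have hbd : ∀ r : ℝ, |∫ y in ball 0 r, inner ℝ (vecKernel b y) (G (x - y))| ≤ ∫ y, Q y := by
    intro r
    rw [← Real.norm_eq_abs]
    refine (norm_integral_le_of_norm_le hQi.integrableOn (Eventually.of_forall hQ0)).trans ?_
    exact setIntegral_le_integral hQi
      (Eventually.of_forall fun y => (norm_nonneg _).trans (hQ0 y))
  have h1 := le_of_tendsto (hlim φ hφ hc x).abs (Eventually.of_forall hbd)
  rw [abs_mul, abs_of_pos hA, hQ, integral_add hQ1 hQ2, integral_indicator measurableSet_ball,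
    integral_indicator measurableSet_ball.compl, integral_const_mul] at h1
  refine h1.trans (add_le_add le_rfl ?_)
  rw [mul_right_comm]
  exact mul_le_mul_of_nonneg_right hn.le hM0

/-- A compactly supported function is controlled by the convolution of its fractional gradient
with the truncated Riesz kernel, up to a small multiple of its `L^1` norm. -/
theorem exists_abs_le_setIntegral_fracGradient [NeZero d] {s : ℝ} (hs0 : 0 < s) (hs1 : s ≤ 1) :
    ∃ A : ℝ, 0 < A ∧ ∀ B η : ℝ, 0 < B → 0 < η → ∃ R : ℝ,
      ∀ φ : EuclideanSpace ℝ (Fin d) → ℝ, ContDiff ℝ 1 φ → HasCompactSupport φ →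
      (∀ z, φ z ≠ 0 → ‖z‖ < B) → ∀ x, ‖x‖ < B →
      A * |φ x| ≤ (∫ y in ball 0 R, ‖y‖ ^ (-((d : ℝ) - s)) * ‖fracGradient s φ (x - y)‖) +
        η * ∫ z, ‖φ z‖ := by
  rcases hs1.eq_or_lt with rfl | hs1
  · refine ⟨sphereArea d, sphereArea_pos d, fun B η _ hη => ?_⟩
    obtain ⟨R, hR⟩ := exists_abs_le_setIntegral_gradient (d := d) B
    refine ⟨R, fun φ hφ hc hφB x hx => (hR φ hφ hc hφB x hx).trans ?_⟩
    simp only [fracGradient, if_pos]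
    exact le_add_of_nonneg_right (mul_nonneg hη.le (integral_nonneg fun _ => norm_nonneg _))
  · have hd : (1 : ℝ) ≤ d := by exact_mod_cast NeZero.one_le
    obtain ⟨c, hc0, hc⟩ := exists_fracGradient_eq (d := d) hs0 hs1
    -- The exponent `b` is forced by `a + b = 2d`, and `b - 1 = d - s` is the exponent of the kernel
    -- in the conclusion.
    obtain ⟨A, hA, h⟩ := exists_abs_le_setIntegral_gradient_powerPotential (d := d)
      (a := d + s - 1) (b := d - s + 1) (by linarith) (by linarith) (by linarith) (by ring)
      (by linarith)
    refine ⟨c * A, mul_pos hc0 hA, fun B η hB hη => ?_⟩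
    obtain ⟨R, hR⟩ := h B (η / c) hB (div_pos hη hc0)
    refine ⟨R, fun φ hφ hφc hφB x hx => ?_⟩
    have h1 := mul_le_mul_of_nonneg_left (hR φ hφ hφc hφB x hx) hc0.le
    rw [mul_assoc]
    refine h1.trans (le_of_eq ?_)
    rw [mul_add, ← mul_assoc, mul_div_cancel₀ _ hc0.ne', ← integral_const_mul]
    congr 1
    refine integral_congr_ae (Eventually.of_forall fun y => ?_)
    simp only [hc φ hφ hφc, norm_smul, Real.norm_of_nonneg hc0.le]
    rw [show (d : ℝ) - s + 1 - 1 = d - s by ring]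
    ring

end FracGradient

/-! ### Young's inequality and the truncated kernel -/

section Embedding

variable {d : ℕ}

/-- The splitting behind Young's inequality: the three outer exponents add up to `1`, ready for
Hölder with three factors. -/
theorem ENNReal.mul_eq_rpow_mul_rpow_mul_rpow {u v : ℝ≥0∞} {p m t : ℝ} (hp : 1 ≤ p) (hm : 1 ≤ m)
    (ht : 0 < t) (h : 1 + 1 / t = 1 / m + 1 / p) :
    u * v = (u ^ m * v ^ p) ^ (1 / t) * (u ^ m) ^ (1 - 1 / p) * (v ^ p) ^ (1 - 1 / m) := by
  have hp0 : 0 < p := by linarith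
  have hm0 : 0 < m := by linarith
  have hp1 : 1 / p ≤ 1 := (div_le_one hp0).2 hp
  have hm1 : 1 / m ≤ 1 := (div_le_one hm0).2 hm
  have ht1 : 0 ≤ 1 / t := by positivity
  have e1 : (u ^ m) ^ (1 / t) * (u ^ m) ^ (1 - 1 / p) = u := by
    rw [← ENNReal.rpow_add_of_nonneg _ _ ht1 (by linarith),
      show 1 / t + (1 - 1 / p) = 1 / m by linarith, ← ENNReal.rpow_mul,
      mul_one_div_cancel hm0.ne', ENNReal.rpow_one]
  have e2 : (v ^ p) ^ (1 / t) * (v ^ p) ^ (1 - 1 / m) = v := by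
    rw [← ENNReal.rpow_add_of_nonneg _ _ ht1 (by linarith),
      show 1 / t + (1 - 1 / m) = 1 / p by linarith, ← ENNReal.rpow_mul,
      mul_one_div_cancel hp0.ne', ENNReal.rpow_one]
  calc u * v = ((u ^ m) ^ (1 / t) * (u ^ m) ^ (1 - 1 / p)) *
      ((v ^ p) ^ (1 / t) * (v ^ p) ^ (1 - 1 / m)) := by rw [e1, e2]
    _ = _ := by
      rw [ENNReal.mul_rpow_of_nonneg _ _ ht1]
      ring

/-- Young's convolution inequality. -/
theorem eLpNorm_lintegral_mul_comp_sub_le {k g : EuclideanSpace ℝ (Fin d) → ℝ≥0∞}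
    (hk : Measurable k) (hg : Measurable g) {p m t : ℝ} (hp : 1 ≤ p) (hm : 1 ≤ m) (ht : 0 < t)
    (h : 1 + 1 / t = 1 / m + 1 / p) :
    eLpNorm (fun x => ∫⁻ y, k y * g (x - y)) (ENNReal.ofReal t) volume ≤
      (∫⁻ y, k y ^ m) ^ (1 / m) * (∫⁻ y, g y ^ p) ^ (1 / p) := by
  have hp0 : 0 < p := by linarith
  have hm0 : 0 < m := by linarith
  have hp1 : 1 / p ≤ 1 := (div_le_one hp0).2 hp
  have hm1 : 1 / m ≤ 1 := (div_le_one hm0).2 hm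
  set K := ∫⁻ y, k y ^ m with hK
  set G := ∫⁻ y, g y ^ p with hG
  have hGx : ∀ x, ∫⁻ y, g (x - y) ^ p = G := fun x =>
    lintegral_sub_left_eq_self (fun y => g y ^ p) x
  have hpt : ∀ x, ∫⁻ y, k y * g (x - y) ≤
      (∫⁻ y, k y ^ m * g (x - y) ^ p) ^ (1 / t) * K ^ (1 - 1 / p) * G ^ (1 - 1 / m) := by
    intro x
    have hgx : Measurable fun y => g (x - y) := hg.comp (measurable_const.sub measurable_id)
    have := ENNReal.lintegral_prod_norm_pow_le (μ := (volume : Measure (EuclideanSpace ℝ (Fin d))))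
      Finset.univ
      (f := ![fun y => k y ^ m * g (x - y) ^ p, fun y => k y ^ m, fun y => g (x - y) ^ p])
      (p := ![1 / t, 1 - 1 / p, 1 - 1 / m]) ?_ ?_ ?_
    · simp only [Fin.prod_univ_three, Matrix.cons_val_zero, Matrix.cons_val_one,
        Matrix.cons_val] at this
      rw [hGx] at this
      refine le_of_eq_of_le (lintegral_congr fun y => ?_) this
      exact ENNReal.mul_eq_rpow_mul_rpow_mul_rpow hp hm ht h
    · intro i _
      fin_cases i
      · exact ((hk.pow_const m).mul (hgx.pow_const p)).aemeasurable
      · exact (hk.pow_const m).aemeasurable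
      · exact (hgx.pow_const p).aemeasurable
    · simp only [Fin.sum_univ_three, Matrix.cons_val_zero, Matrix.cons_val_one, Matrix.cons_val]
      linarith
    · intro i _
      fin_cases i
      · simp only [Fin.zero_eta, Matrix.cons_val_zero]
        positivity
      · simpa using hp1
      · simpa using hm1
  have hswap : ∫⁻ x, ∫⁻ y, k y ^ m * g (x - y) ^ p = K * G := by
    rw [lintegral_lintegral_swap]
    · calc ∫⁻ y, ∫⁻ x, k y ^ m * g (x - y) ^ p = ∫⁻ y, k y ^ m * G := by
            refine lintegral_congr fun y => ?_
            have hgy : Measurable fun x => g (x - y) :=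
              hg.comp (measurable_id.sub measurable_const)
            rw [lintegral_const_mul _ (hgy.pow_const p),
              lintegral_sub_right_eq_self (fun x => g x ^ p)]
        _ = K * G := lintegral_mul_const _ (hk.pow_const m)
    · exact (((hk.comp measurable_snd).pow_const m).mul
        ((hg.comp (measurable_fst.sub measurable_snd)).pow_const p)).aemeasurable
  have ht0 : ENNReal.ofReal t ≠ 0 := by simpa using ht
  rw [eLpNorm_eq_lintegral_rpow_enorm_toReal ht0 ENNReal.ofReal_ne_top,
    ENNReal.toReal_ofReal ht.le]
  simp only [enorm_eq_self]
  have hle : ∫⁻ x, (∫⁻ y, k y * g (x - y)) ^ t ≤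
      K * G * (K ^ (1 - 1 / p)) ^ t * (G ^ (1 - 1 / m)) ^ t := by
    have hmeas : Measurable fun x => ∫⁻ y, k y ^ m * g (x - y) ^ p :=
      Measurable.lintegral_prod_right' (f := fun z : EuclideanSpace ℝ (Fin d) ×
        EuclideanSpace ℝ (Fin d) => k z.2 ^ m * g (z.1 - z.2) ^ p)
        (((hk.comp measurable_snd).pow_const m).mul
          ((hg.comp (measurable_fst.sub measurable_snd)).pow_const p))
    calc ∫⁻ x, (∫⁻ y, k y * g (x - y)) ^ t
        ≤ ∫⁻ x, (∫⁻ y, k y ^ m * g (x - y) ^ p) * (K ^ (1 - 1 / p)) ^ t *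
            (G ^ (1 - 1 / m)) ^ t := by
          refine lintegral_mono fun x => (ENNReal.rpow_le_rpow (hpt x) ht.le).trans (le_of_eq ?_)
          rw [ENNReal.mul_rpow_of_nonneg _ _ ht.le, ENNReal.mul_rpow_of_nonneg _ _ ht.le,
            ← ENNReal.rpow_mul, one_div_mul_cancel ht.ne', ENNReal.rpow_one]
      _ = _ := by
          rw [lintegral_mul_const _ (hmeas.mul_const _), lintegral_mul_const _ hmeas, hswap]
  have ht1 : 0 ≤ 1 / t := by positivity
  refine (ENNReal.rpow_le_rpow hle ht1).trans (le_of_eq ?_)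
  rw [ENNReal.mul_rpow_of_nonneg _ _ ht1, ENNReal.mul_rpow_of_nonneg _ _ ht1,
    ← ENNReal.rpow_mul _ t, ← ENNReal.rpow_mul _ t, mul_one_div_cancel ht.ne', ENNReal.rpow_one,
    ENNReal.rpow_one, ENNReal.mul_rpow_of_nonneg _ _ ht1]
  have e1 : K ^ (1 / m) = K ^ (1 / t) * K ^ (1 - 1 / p) := by
    rw [← ENNReal.rpow_add_of_nonneg _ _ ht1 (by linarith)]
    congr 1
    linarith
  have e2 : G ^ (1 / p) = G ^ (1 / t) * G ^ (1 - 1 / m) := by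
    rw [← ENNReal.rpow_add_of_nonneg _ _ ht1 (by linarith)]
    congr 1
    linarith
  rw [e1, e2]
  ring

theorem lintegral_truncated_kernel_rpow_lt_top [NeZero d] {s m : ℝ} (hm : 0 < m)
    (h : ((d : ℝ) - s) * m < d) (R : ℝ) :
    ∫⁻ y : EuclideanSpace ℝ (Fin d),
      (ball 0 R).indicator (fun y => ENNReal.ofReal (‖y‖ ^ (-((d : ℝ) - s)))) y ^ m < ∞ := by
  have h1 := (integrable_indicator_iff measurableSet_ball).2
    (integrableOn_ball_norm_rpow (d := d) h R)
  refine lt_of_le_of_lt (lintegral_mono fun y => ?_) h1.2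
  by_cases hy : y ∈ ball (0 : EuclideanSpace ℝ (Fin d)) R
  · simp only [indicator_of_mem hy]
    rw [ENNReal.ofReal_rpow_of_nonneg (by positivity) hm.le, ← Real.rpow_mul (norm_nonneg _),
      Real.enorm_of_nonneg (by positivity), neg_mul]
  · simp [hy, hm]

theorem ofReal_setIntegral_eq_lintegral [NeZero d] {s : ℝ} (hs : 0 < s)
    {g : EuclideanSpace ℝ (Fin d) → EuclideanSpace ℝ (Fin d)} (hg : Continuous g)
    (x : EuclideanSpace ℝ (Fin d)) (R : ℝ) :
    ENNReal.ofReal (∫ y in ball 0 R, ‖y‖ ^ (-((d : ℝ) - s)) * ‖g (x - y)‖) =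
      ∫⁻ y, (ball 0 R).indicator (fun y => ENNReal.ofReal (‖y‖ ^ (-((d : ℝ) - s)))) y *
        ‖g (x - y)‖ₑ := by
  rw [ofReal_integral_eq_lintegral_ofReal
    (integrableOn_rpow_mul_norm_comp_sub (by linarith) hg x R)
    (Eventually.of_forall fun y => by positivity), ← lintegral_indicator measurableSet_ball]
  refine lintegral_congr fun y => ?_
  by_cases hy : y ∈ ball (0 : EuclideanSpace ℝ (Fin d)) R
  · simp only [indicator_of_mem hy]
    rw [ENNReal.ofReal_mul (by positivity), ofReal_norm]
  · simp [hy]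

end Embedding

/-! ### The subcritical fractional Sobolev inequality for test functions -/

section Embedding

variable {d : ℕ}

/-- Fractional Sobolev inequality in the subcritical range, for exponents at least `p`. -/
theorem exists_eLpNorm_le_fracGradient_of_le [NeZero d] {s : ℝ} (hs0 : 0 < s) (hs1 : s ≤ 1)
    {p t : ℝ} (hp : 1 ≤ p) (hpt : p ≤ t) (hst : 1 / p - s / d < 1 / t) {B : ℝ} (hB : 0 < B) :
    ∃ C : ℝ≥0, ∀ φ : EuclideanSpace ℝ (Fin d) → ℝ, ContDiff ℝ 1 φ → HasCompactSupport φ →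
      (∀ z, φ z ≠ 0 → ‖z‖ < B) →
      eLpNorm φ (ENNReal.ofReal t) volume ≤
        C * eLpNorm (fracGradient s φ) (ENNReal.ofReal p) volume := by
  have hd : (1 : ℝ) ≤ d := by exact_mod_cast NeZero.one_le
  have hp0 : 0 < p := by linarith
  have ht0 : 0 < t := by linarith
  have ht1 : 1 ≤ t := by linarith
  have hp1 : 1 / p ≤ 1 := (div_le_one hp0).2 hp
  have htp : 1 / t ≤ 1 / p := one_div_le_one_div_of_le hp0 hpt
  have ht' : 0 < 1 / t := by positivity
  -- The exponent dictated by Young's inequality. Subcriticality of `t` is exactly `(d - s) m < d`,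
  -- that is, local `L^m` integrability of the kernel.
  set m := 1 / (1 + 1 / t - 1 / p) with hm
  have hm0 : 0 < m := by
    rw [hm, one_div_pos]
    linarith
  have hm' : 1 / m = 1 + 1 / t - 1 / p := by rw [hm, one_div_one_div]
  have hm1 : 1 ≤ m := by
    rw [← div_le_one hm0, hm']
    linarith
  have hmd : ((d : ℝ) - s) * m < d := by
    rw [← lt_div_iff₀ hm0, div_eq_mul_one_div, hm']
    have h1 : (d : ℝ) * (1 / p - s / d) < d * (1 / t) :=
      mul_lt_mul_of_pos_left hst (by linarith)
    rw [mul_sub, mul_div_cancel₀ _ (by linarith)] at h1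
    linarith
  obtain ⟨A, hA, hrep⟩ := exists_abs_le_setIntegral_fracGradient (d := d) hs0 hs1
  set V := volume (ball (0 : EuclideanSpace ℝ (Fin d)) B) with hV
  have hVtop : V ≠ ∞ := measure_ball_lt_top.ne
  have hV0 : V ≠ 0 := (measure_ball_pos volume _ hB).ne'
  -- Integrated over the ball of volume `V`, the error term becomes half of the left side and can be
  -- absorbed.
  set η := A / (2 * V.toReal) with hη
  have hVr : 0 < V.toReal := ENNReal.toReal_pos hV0 hVtop
  have hη0 : 0 < η := by positivity
  have hηV : ENNReal.ofReal η * V = ENNReal.ofReal (A / 2) := by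
    rw [← ENNReal.ofReal_toReal hVtop, ← ENNReal.ofReal_mul hη0.le, hη]
    congr 1
    field_simp
  obtain ⟨R, hR⟩ := hrep B η hB hη0
  set k : EuclideanSpace ℝ (Fin d) → ℝ≥0∞ :=
    (ball 0 R).indicator (fun y => ENNReal.ofReal (‖y‖ ^ (-((d : ℝ) - s)))) with hk
  have hkm : Measurable k :=
    ((measurable_norm_rpow _).ennreal_ofReal).indicator measurableSet_ball
  set Kc := (∫⁻ y, k y ^ m) ^ (1 / m) with hKc
  have hKtop : Kc ≠ ∞ := ENNReal.rpow_ne_top_of_nonneg (by positivity)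
    (lintegral_truncated_kernel_rpow_lt_top hm0 hmd R).ne
  set D := (ENNReal.ofReal A)⁻¹ * (1 + ENNReal.ofReal η * ((ENNReal.ofReal (A / 2))⁻¹ *
    V ^ (1 - 1 / t)) * V ^ (1 / t)) * Kc with hD
  have hA0 : ENNReal.ofReal A ≠ 0 := by simpa using hA
  have hA20 : ENNReal.ofReal (A / 2) ≠ 0 := by simpa using hA
  have hDtop : D ≠ ∞ := by
    refine ENNReal.mul_ne_top (ENNReal.mul_ne_top (ENNReal.inv_ne_top.2 hA0)
      (ENNReal.add_ne_top.2 ⟨ENNReal.one_ne_top, ENNReal.mul_ne_top (ENNReal.mul_ne_top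
        ENNReal.ofReal_ne_top (ENNReal.mul_ne_top (ENNReal.inv_ne_top.2 hA20) ?_)) ?_⟩)) hKtop
    · exact ENNReal.rpow_ne_top_of_ne_zero hV0 hVtop
    · exact ENNReal.rpow_ne_top_of_ne_zero hV0 hVtop
  refine ⟨D.toNNReal, fun φ hφ hc hφB => ?_⟩
  rw [ENNReal.coe_toNNReal hDtop]
  set g := fracGradient s φ with hg
  have hgc : Continuous g := continuous_fracGradient hs0 hs1 hφ hc
  set I : EuclideanSpace ℝ (Fin d) → ℝ≥0∞ := fun x => ∫⁻ y, k y * ‖g (x - y)‖ₑ with hI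
  have hgm : Measurable fun y => ‖g y‖ₑ := hgc.measurable.enorm
  have hIm : Measurable I :=
    Measurable.lintegral_prod_right' (f := fun z : EuclideanSpace ℝ (Fin d) ×
      EuclideanSpace ℝ (Fin d) => k z.2 * ‖g (z.1 - z.2)‖ₑ)
      ((hkm.comp measurable_snd).mul (hgm.comp (measurable_fst.sub measurable_snd)))
  set μ := (volume : Measure (EuclideanSpace ℝ (Fin d))).restrict (ball 0 B) with hμ
  have hμV : μ univ = V := by simp [hμ, hV]
  have hsupp : Function.support φ ⊆ ball 0 B := fun z hz => by simpa using hφB z hz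
  set N := ∫⁻ z, ‖φ z‖ₑ with hN
  have hL1 : Integrable φ := hφ.continuous.integrable_of_hasCompactSupport hc
  have hNtop : N ≠ ∞ := hL1.2.ne
  have hNμ : N = ∫⁻ z, ‖φ z‖ₑ ∂μ := by
    rw [hN, ← eLpNorm_one_eq_lintegral_enorm, ← eLpNorm_one_eq_lintegral_enorm,
      eLpNorm_restrict_eq_of_support_subset hsupp]
  have hpoint : ∀ᵐ x ∂μ, ENNReal.ofReal A * ‖φ x‖ₑ ≤ I x + ENNReal.ofReal η * N := by
    filter_upwards [ae_restrict_mem measurableSet_ball] with x hx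
    have h1 := ENNReal.ofReal_le_ofReal (hR φ hφ hc hφB x (by simpa using hx))
    rw [ENNReal.ofReal_mul hA.le, ENNReal.ofReal_add (integral_nonneg fun _ => by positivity)
      (mul_nonneg hη0.le (integral_nonneg fun _ => norm_nonneg _)),
      ofReal_setIntegral_eq_lintegral hs0 hgc, ENNReal.ofReal_mul hη0.le,
      ofReal_integral_norm_eq_lintegral_enorm hL1, ← Real.norm_eq_abs, ofReal_norm] at h1
    exact h1
  set X := eLpNorm I (ENNReal.ofReal t) μ with hX
  have hXle : X ≤ Kc * eLpNorm g (ENNReal.ofReal p) volume := by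
    refine (eLpNorm_mono_measure I Measure.restrict_le_self).trans ?_
    have := eLpNorm_lintegral_mul_comp_sub_le hkm hgm hp hm1 ht0 (by rw [hm']; ring)
    rwa [eLpNorm_eq_lintegral_rpow_enorm_toReal (f := g) (by simpa using hp0)
      ENNReal.ofReal_ne_top, ENNReal.toReal_ofReal hp0.le]
  have hN1 : ENNReal.ofReal (A / 2) * N ≤ X * V ^ (1 - 1 / t) := by
    have h1 : ENNReal.ofReal A * N ≤ (∫⁻ x, I x ∂μ) + ENNReal.ofReal (A / 2) * N := by
      calc ENNReal.ofReal A * N = ∫⁻ x, ENNReal.ofReal A * ‖φ x‖ₑ ∂μ := by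
            rw [lintegral_const_mul _ hφ.continuous.measurable.enorm, hNμ]
        _ ≤ ∫⁻ x, (I x + ENNReal.ofReal η * N) ∂μ := lintegral_mono_ae hpoint
        _ = _ := by
            rw [lintegral_add_left hIm, lintegral_const, hμV, mul_right_comm, hηV]
    have h2 : ENNReal.ofReal A = ENNReal.ofReal (A / 2) + ENNReal.ofReal (A / 2) := by
      rw [← ENNReal.ofReal_add (by positivity) (by positivity), add_halves]
    rw [h2, add_mul] at h1
    -- The absorption cancels an extended real, so it needs the `L^1` norm of `φ` to be finite.
    have h3 := (ENNReal.add_le_add_iff_right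
      (ENNReal.mul_ne_top ENNReal.ofReal_ne_top hNtop)).1 h1
    refine h3.trans ?_
    have h4 := eLpNorm_le_eLpNorm_mul_rpow_measure_univ (μ := μ) (f := I) (p := 1)
      (q := ENNReal.ofReal t) (by simpa using ht1) hIm.aestronglyMeasurable
    rw [eLpNorm_one_eq_lintegral_enorm, hμV, ENNReal.toReal_ofReal ht0.le] at h4
    simpa using h4
  have hN2 : N ≤ (ENNReal.ofReal (A / 2))⁻¹ * V ^ (1 - 1 / t) * X := by
    rw [mul_assoc, mul_comm (V ^ _) X, ← ENNReal.div_eq_inv_mul,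
      ENNReal.le_div_iff_mul_le (Or.inl hA20) (Or.inl ENNReal.ofReal_ne_top), mul_comm]
    exact hN1
  have hmain : ENNReal.ofReal A * eLpNorm φ (ENNReal.ofReal t) volume ≤
      X + ENNReal.ofReal η * N * V ^ (1 / t) := by
    have h1 : ENNReal.ofReal A * eLpNorm φ (ENNReal.ofReal t) volume =
        eLpNorm (A • φ) (ENNReal.ofReal t) μ := by
      rw [eLpNorm_const_smul, eLpNorm_restrict_eq_of_support_subset hsupp,
        Real.enorm_of_nonneg hA.le]
    rw [h1]
    have h2 : eLpNorm (A • φ) (ENNReal.ofReal t) μ ≤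
        eLpNorm (I + fun _ => ENNReal.ofReal η * N) (ENNReal.ofReal t) μ := by
      refine eLpNorm_mono_enorm_ae ?_
      filter_upwards [hpoint] with x hx
      simpa [enorm_smul, Real.enorm_of_nonneg hA.le] using hx
    refine h2.trans ((eLpNorm_add_le hIm.aestronglyMeasurable aestronglyMeasurable_const
      (by simpa using ht1)).trans (add_le_add le_rfl (le_of_eq ?_)))
    have hμ0 : μ ≠ 0 := by
      intro h
      rw [h] at hμV
      exact hV0 (by simpa using hμV.symm)
    rw [eLpNorm_const _ (by simpa using ht0) hμ0, hμV, ENNReal.toReal_ofReal ht0.le,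
      enorm_eq_self]
  calc eLpNorm φ (ENNReal.ofReal t) volume
      ≤ (ENNReal.ofReal A)⁻¹ * (X + ENNReal.ofReal η * N * V ^ (1 / t)) := by
        rw [← ENNReal.div_eq_inv_mul,
          ENNReal.le_div_iff_mul_le (Or.inl hA0) (Or.inl ENNReal.ofReal_ne_top), mul_comm]
        exact hmain
    _ ≤ (ENNReal.ofReal A)⁻¹ * (X + ENNReal.ofReal η *
          ((ENNReal.ofReal (A / 2))⁻¹ * V ^ (1 - 1 / t) * X) * V ^ (1 / t)) := by gcongr
    _ = (ENNReal.ofReal A)⁻¹ * (1 + ENNReal.ofReal η * ((ENNReal.ofReal (A / 2))⁻¹ *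
          V ^ (1 - 1 / t)) * V ^ (1 / t)) * X := by ring
    _ ≤ (ENNReal.ofReal A)⁻¹ * (1 + ENNReal.ofReal η * ((ENNReal.ofReal (A / 2))⁻¹ *
          V ^ (1 - 1 / t)) * V ^ (1 / t)) * (Kc * eLpNorm g (ENNReal.ofReal p) volume) := by gcongr
    _ = _ := by rw [hD]; ring

/-- In reciprocals the two cases merge: if `s p ≥ d`, the left side of the inequality is nonpositive
and the condition is automatic. -/
theorem lt_sobolevExponent_iff [NeZero d] {s p t : ℝ} (hp : 0 < p) (ht : 0 < t) :
    ENNReal.ofReal t < sobolevExponent d s p ↔ 1 / p - s / d < 1 / t := by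
  have hd : (0 : ℝ) < d := by exact_mod_cast Nat.pos_of_ne_zero (NeZero.ne d)
  rw [sobolevExponent]
  have e : 1 / p - s / d = (d - s * p) / (d * p) := by field_simp
  split_ifs with h
  · rw [ENNReal.ofReal_lt_ofReal_iff_of_nonneg ht.le, e, lt_div_iff₀ (by linarith),
      div_lt_div_iff₀ (by positivity) ht, one_mul, mul_comm t]
  · simp only [ENNReal.ofReal_lt_top, true_iff, e]
    exact lt_of_le_of_lt (div_nonpos_of_nonpos_of_nonneg (by linarith) (by positivity))
      (by positivity)

/-- Fractional Sobolev inequality in the subcritical range, on a bounded set. -/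
theorem exists_eLpNorm_le_fracGradient [NeZero d] {s : ℝ} (hs0 : 0 < s) (hs1 : s ≤ 1)
    {p : ℝ} (hp : 1 ≤ p) {r : ℝ≥0∞} (hr : r < sobolevExponent d s p) {B : ℝ} (hB : 0 < B) :
    ∃ C : ℝ≥0, ∀ φ : EuclideanSpace ℝ (Fin d) → ℝ, ContDiff ℝ 1 φ → HasCompactSupport φ →
      (∀ z, φ z ≠ 0 → ‖z‖ < B) →
      eLpNorm φ r volume ≤ C * eLpNorm (fracGradient s φ) (ENNReal.ofReal p) volume := by
  have hd : (0 : ℝ) < d := by exact_mod_cast Nat.pos_of_ne_zero (NeZero.ne d)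
  have hp0 : 0 < p := by linarith
  have hrtop : r ≠ ∞ := (hr.trans_le le_top).ne
  rcases le_total (ENNReal.ofReal p) r with hpr | hpr
  · have h1 : p ≤ r.toReal := (ENNReal.ofReal_le_iff_le_toReal hrtop).1 hpr
    rw [← ENNReal.ofReal_toReal hrtop] at hr ⊢
    exact exists_eLpNorm_le_fracGradient_of_le hs0 hs1 hp h1
      ((lt_sobolevExponent_iff hp0 (by linarith)).1 hr) hB
  -- Below `p`, the case `t = p` is combined with Hölder on a ball of finite volume.
  · obtain ⟨C, hC⟩ := exists_eLpNorm_le_fracGradient_of_le (d := d) hs0 hs1 hp le_rfl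
      (by linarith [div_pos hs0 hd]) hB
    rcases eq_or_ne r 0 with rfl | hr0
    · exact ⟨0, fun φ _ _ _ => by simp⟩
    set V := volume (ball (0 : EuclideanSpace ℝ (Fin d)) B) with hV
    have hVtop : V ≠ ∞ := measure_ball_lt_top.ne
    have hV0 : V ≠ 0 := (measure_ball_pos volume _ hB).ne'
    set e := 1 / r.toReal - 1 / (ENNReal.ofReal p).toReal
    have hVe : V ^ e ≠ ∞ := ENNReal.rpow_ne_top_of_ne_zero hV0 hVtop
    refine ⟨C * (V ^ e).toNNReal, fun φ hφ hc hφB => ?_⟩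
    have hsupp : Function.support φ ⊆ ball 0 B := fun z hz => by simpa using hφB z hz
    rw [ENNReal.coe_mul, ENNReal.coe_toNNReal hVe]
    have h1 := eLpNorm_le_eLpNorm_mul_rpow_measure_univ (f := φ) hpr
      (μ := (volume : Measure (EuclideanSpace ℝ (Fin d))).restrict (ball 0 B))
      hφ.continuous.aestronglyMeasurable
    rw [eLpNorm_restrict_eq_of_support_subset hsupp, eLpNorm_restrict_eq_of_support_subset hsupp,
      Measure.restrict_apply_univ] at h1
    calc eLpNorm φ r volume ≤ eLpNorm φ (ENNReal.ofReal p) volume * V ^ e := h1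
      _ ≤ C * eLpNorm (fracGradient s φ) (ENNReal.ofReal p) volume * V ^ e := by
        gcongr
        exact hC φ hφ hc hφB
      _ = _ := by ring

end Embedding

/-! ### Passage to the closure: Sobolev and Poincaré inequalities -/

section Closure

variable {d : ℕ} {s p : ℝ} {Ω : Opens (EuclideanSpace ℝ (Fin d))}

theorem TestFunction.contDiff_one (φ : 𝓓(Ω, ℝ)) : ContDiff ℝ 1 φ :=
  φ.contDiff.of_le (by exact_mod_cast le_top)

/-- The graph of `D^s` over the test functions is already a linear subspace. -/
theorem exists_testFunction_of_mem_span [NeZero d] (hs0 : 0 < s) (hs1 : s ≤ 1) {x : LpPair d p}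
    (hx : x ∈ Submodule.span ℝ {x : LpPair d p | ∃ φ : 𝓓(Ω, ℝ), x.fst =ᵐ[volume] φ ∧
      x.snd =ᵐ[volume] fracGradient s φ}) :
    ∃ φ : 𝓓(Ω, ℝ), x.fst =ᵐ[volume] φ ∧ x.snd =ᵐ[volume] fracGradient s φ := by
  induction hx using Submodule.span_induction with
  | mem x hx => exact hx
  | zero =>
    refine ⟨0, Lp.coeFn_zero _ _ _, ?_⟩
    filter_upwards [Lp.coeFn_zero (EuclideanSpace ℝ (Fin d)) (ENNReal.ofReal p)
      (volume : Measure (EuclideanSpace ℝ (Fin d)))] with y hy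
    have h := fracGradient_smul hs0 hs1 0 (TestFunction.contDiff_one (0 : 𝓓(Ω, ℝ)))
      (0 : 𝓓(Ω, ℝ)).hasCompactSupport y
    rw [zero_smul, zero_smul] at h
    exact hy.trans h.symm
  | add x z _ _ hx hz =>
    obtain ⟨φ, h1, h2⟩ := hx
    obtain ⟨ψ, h3, h4⟩ := hz
    refine ⟨φ + ψ, ?_, ?_⟩
    · filter_upwards [h1, h3, Lp.coeFn_add x.fst z.fst] with y h1 h3 h
      exact h.trans (congrArg₂ (· + ·) h1 h3)
    · filter_upwards [h2, h4, Lp.coeFn_add x.snd z.snd] with y h2 h4 h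
      refine h.trans ((congrArg₂ (· + ·) h2 h4).trans ?_)
      exact (fracGradient_add hs0 hs1 φ.contDiff_one φ.hasCompactSupport ψ.contDiff_one
        ψ.hasCompactSupport y).symm
  | smul c x _ hx =>
    obtain ⟨φ, h1, h2⟩ := hx
    refine ⟨c • φ, ?_, ?_⟩
    · filter_upwards [h1, Lp.coeFn_smul c x.fst] with y h1 h
      exact h.trans (congrArg (c • ·) h1)
    · filter_upwards [h2, Lp.coeFn_smul c x.snd] with y h2 h
      refine h.trans ((congrArg (c • ·) h2).trans ?_)
      exact (fracGradient_smul hs0 hs1 c φ.contDiff_one φ.hasCompactSupport y).symm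

variable [Fact (1 < p)]

/-- The subcritical Sobolev embedding of `Λ^{s,p}_0(Ω)`; for `r = p` this is the Poincaré
inequality. -/
theorem exists_eLpNorm_fn_le [NeZero d] (hs0 : 0 < s) (hs1 : s ≤ 1)
    (hΩ : Bornology.IsBounded (Ω : Set (EuclideanSpace ℝ (Fin d)))) {r : ℝ≥0∞}
    (hr : r < sobolevExponent d s p) :
    ∃ C : ℝ≥0, ∀ w : LionsCalderon s p Ω,
      eLpNorm w.fn r volume ≤ C * ‖(w : LpPair d p).snd‖ₑ := by
  have hp : 1 < p := Fact.out
  obtain ⟨B, hB0, hB⟩ := hΩ.subset_ball_lt 0 0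
  obtain ⟨C, hC⟩ := exists_eLpNorm_le_fracGradient (d := d) hs0 hs1 hp.le hr hB0
  refine ⟨C, fun w => ?_⟩
  obtain ⟨x, hx, hlim⟩ := mem_closure_iff_seq_limit.1 w.2
  have hbound : ∀ n, eLpNorm (x n).fst r volume ≤ C * ‖(x n).snd‖ₑ := by
    intro n
    obtain ⟨φ, h1, h2⟩ := exists_testFunction_of_mem_span hs0 hs1 (hx n)
    rw [eLpNorm_congr_ae h1, Lp.enorm_def, eLpNorm_congr_ae h2]
    refine hC φ φ.contDiff_one φ.hasCompactSupport fun z hz => ?_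
    simpa using hB (φ.tsupport_subset (subset_tsupport _ hz))
  have hfst : Tendsto (fun n => (x n).fst) atTop (𝓝 (w : LpPair d p).fst) :=
    ((WithLp.fstL (ENNReal.ofReal p) ℝ _ _).continuous.tendsto _).comp hlim
  have hsnd : Tendsto (fun n => (x n).snd) atTop (𝓝 (w : LpPair d p).snd) :=
    ((WithLp.sndL (ENNReal.ofReal p) ℝ _ _).continuous.tendsto _).comp hlim
  -- Convergence in `L^p` says nothing directly about the `L^r` norm. An almost everywhere
  -- convergent subsequence makes Fatou's lemma available, and lower semicontinuity suffices.
  obtain ⟨ns, hns, hae⟩ := (tendstoInMeasure_of_tendsto_Lp hfst).exists_seq_tendsto_ae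
  refine (Lp.eLpNorm_lim_le_liminf_eLpNorm (f := fun n => ((x (ns n)).fst : _ → ℝ))
    (fun n => Lp.aestronglyMeasurable _) _ hae).trans ?_
  have hlim2 : Tendsto (fun n => (C : ℝ≥0∞) * ‖(x (ns n)).snd‖ₑ) atTop
      (𝓝 (C * ‖(w : LpPair d p).snd‖ₑ)) :=
    ENNReal.Tendsto.const_mul ((continuous_enorm.tendsto _).comp
      (hsnd.comp hns.tendsto_atTop)) (Or.inr ENNReal.coe_ne_top)
  rw [← hlim2.liminf_eq]
  exact liminf_le_liminf (Eventually.of_forall fun n => hbound _)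

theorem ofReal_lt_sobolevExponent [NeZero d] (hs0 : 0 < s) :
    ENNReal.ofReal p < sobolevExponent d s p := by
  have hp : 1 < p := Fact.out
  have hd : (0 : ℝ) < d := by exact_mod_cast Nat.pos_of_ne_zero (NeZero.ne d)
  rw [lt_sobolevExponent_iff (by linarith) (by linarith)]
  linarith [div_pos hs0 hd]

/-- The fractional gradient as a continuous linear map into `L^p`. -/
noncomputable def LionsCalderon.gradL (s p : ℝ) [Fact (1 < p)]
    (Ω : Opens (EuclideanSpace ℝ (Fin d))) : LionsCalderon s p Ω →L[ℝ]
      Lp (EuclideanSpace ℝ (Fin d)) (ENNReal.ofReal p)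
        (volume : Measure (EuclideanSpace ℝ (Fin d))) :=
  (WithLp.sndL (ENNReal.ofReal p) ℝ _ _) ∘L (lionsCalderon s p Ω).subtypeL

/-- Poincaré inequality for the full norm. -/
theorem exists_norm_le_gradL [NeZero d] (hs0 : 0 < s) (hs1 : s ≤ 1)
    (hΩ : Bornology.IsBounded (Ω : Set (EuclideanSpace ℝ (Fin d)))) :
    ∃ C : ℝ, 0 ≤ C ∧ ∀ w : LionsCalderon s p Ω, ‖w‖ ≤ C * ‖LionsCalderon.gradL s p Ω w‖ := by
  obtain ⟨C, hC⟩ := exists_eLpNorm_fn_le (p := p) hs0 hs1 hΩ (ofReal_lt_sobolevExponent hs0)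
  refine ⟨C + 1, by positivity, fun w => ?_⟩
  have h1 : ‖(w : LpPair d p).fst‖ ≤ C * ‖(w : LpPair d p).snd‖ := by
    have h2 : ‖(w : LpPair d p).fst‖ₑ ≤ C * ‖(w : LpPair d p).snd‖ₑ := by
      rw [Lp.enorm_def]
      exact hC w
    have h3 := ENNReal.toReal_mono (ENNReal.mul_ne_top ENNReal.coe_ne_top enorm_ne_top) h2
    simpa using h3
  have h4 : ‖(w : LpPair d p)‖ ≤ ‖(w : LpPair d p).fst‖ + ‖(w : LpPair d p).snd‖ := by
    have h5 : (w : LpPair d p) = WithLp.toLp (ENNReal.ofReal p) ((w : LpPair d p).fst, 0) +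
        WithLp.toLp (ENNReal.ofReal p) (0, (w : LpPair d p).snd) := by
      refine WithLp.ofLp_injective _ (Prod.ext ?_ ?_)
      · exact (add_zero _).symm
      · exact (zero_add _).symm
    have h6 := norm_add_le
      (WithLp.toLp (ENNReal.ofReal p) ((w : LpPair d p).fst, 0) : LpPair d p)
      (WithLp.toLp (ENNReal.ofReal p) (0, (w : LpPair d p).snd))
    rwa [← h5, WithLp.norm_toLp_fst, WithLp.norm_toLp_snd] at h6
  calc ‖w‖ = ‖(w : LpPair d p)‖ := rfl
    _ ≤ C * ‖(w : LpPair d p).snd‖ + ‖(w : LpPair d p).snd‖ := h4.trans (by linarith)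
    _ = _ := by
      rw [add_mul, one_mul]
      rfl

end Closure

/-! ### Convexity of the power `|·|^p` -/

section NormPower

variable {F : Type*} [NormedAddCommGroup F]

/-- For equal norms the strictness comes from the unit ball, for different norms from `t ↦ t^p`. -/
theorem norm_half_add_rpow_lt [NormedSpace ℝ F] [StrictConvexSpace ℝ F] {p : ℝ} (hp : 1 < p)
    {a b : F} (hab : a ≠ b) :
    ‖(1 / 2 : ℝ) • (a + b)‖ ^ p < (‖a‖ ^ p + ‖b‖ ^ p) / 2 := by
  have h1 : ‖(1 / 2 : ℝ) • (a + b)‖ = 1 / 2 * ‖a + b‖ := by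
    rw [norm_smul]
    norm_num
  rcases eq_or_ne ‖a‖ ‖b‖ with h | h
  · have h2 : ‖(1 / 2 : ℝ) • (a + b)‖ < ‖b‖ := by
      have := norm_combo_lt_of_ne h.le le_rfl hab (by norm_num : (0 : ℝ) < 1 / 2)
        (by norm_num : (0 : ℝ) < 1 / 2) (by norm_num)
      rwa [← smul_add] at this
    rw [h, add_self_div_two]
    exact Real.rpow_lt_rpow (norm_nonneg _) h2 (by linarith)
  · have h2 := (strictConvexOn_rpow hp).2 (norm_nonneg a) (norm_nonneg b) h
      (by norm_num : (0 : ℝ) < 1 / 2) (by norm_num : (0 : ℝ) < 1 / 2) (by norm_num)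
    simp only [smul_eq_mul] at h2
    have h3 : ‖(1 / 2 : ℝ) • (a + b)‖ ≤ 1 / 2 * ‖a‖ + 1 / 2 * ‖b‖ := by
      rw [h1]
      linarith [norm_add_le a b]
    have h4 := Real.rpow_le_rpow (norm_nonneg _) h3 (by linarith : 0 ≤ p)
    linarith

/-- A quantitative form of the strict convexity of `|·|^p` in finite dimension. -/
theorem exists_norm_sub_rpow_le [NormedSpace ℝ F] [StrictConvexSpace ℝ F]
    [FiniteDimensional ℝ F] {p : ℝ} (hp : 1 < p) {ε : ℝ} (hε : 0 < ε) :
    ∃ C : ℝ, 0 ≤ C ∧ ∀ a b : F, ‖a - b‖ ^ p ≤ ε * (‖a‖ ^ p + ‖b‖ ^ p) +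
      C * ((‖a‖ ^ p + ‖b‖ ^ p) / 2 - ‖(1 / 2 : ℝ) • (a + b)‖ ^ p) := by
  have hp0 : 0 < p := by linarith
  set D : F × F → ℝ := fun z => (‖z.1‖ ^ p + ‖z.2‖ ^ p) / 2 - ‖(1 / 2 : ℝ) • (z.1 + z.2)‖ ^ p
    with hD
  have hc1 : Continuous fun z : F × F => ‖z.1‖ ^ p + ‖z.2‖ ^ p :=
    (continuous_fst.norm.rpow_const fun _ => Or.inr hp0.le).add
      (continuous_snd.norm.rpow_const fun _ => Or.inr hp0.le)
  have hc2 : Continuous fun z : F × F => ‖z.1 - z.2‖ ^ p :=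
    (continuous_fst.sub continuous_snd).norm.rpow_const fun _ => Or.inr hp0.le
  have hDc : Continuous D :=
    (hc1.div_const 2).sub (((continuous_fst.add continuous_snd).const_smul
      (1 / 2 : ℝ)).norm.rpow_const fun _ => Or.inr hp0.le)
  have hDnn : ∀ z, 0 ≤ D z := by
    rintro ⟨a, b⟩
    rcases eq_or_ne a b with rfl | h
    · refine sub_nonneg.2 (le_of_eq ?_)
      rw [← two_smul ℝ a, smul_smul]
      norm_num
    · exact sub_nonneg.2 (norm_half_add_rpow_lt hp h).le
  -- On this compact set the midpoint deficit `D` is positive, so the quotient `|a - b|^p / D` is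
  -- bounded.
  set K : Set (F × F) := {z | ‖z.1‖ ^ p + ‖z.2‖ ^ p = 1 ∧ ε ≤ ‖z.1 - z.2‖ ^ p} with hK
  have hKc : IsCompact K := by
    refine Metric.isCompact_of_isClosed_isBounded ((isClosed_eq hc1 continuous_const).inter
      (isClosed_le continuous_const hc2)) ?_
    refine (isBounded_closedBall (x := (0 : F × F)) (r := 1)).subset fun z hz => ?_
    have h1 : 0 ≤ ‖z.1‖ ^ p := by positivity
    have h2 : 0 ≤ ‖z.2‖ ^ p := by positivity
    have h3 := hz.1
    have h4 : ∀ t : ℝ, 0 ≤ t → t ^ p ≤ 1 → t ≤ 1 := fun t ht h =>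
      by
      by_contra! h1
      exact absurd h (not_le.2 (Real.one_lt_rpow h1 hp0))
    rw [mem_closedBall_zero_iff, Prod.norm_def]
    exact max_le (h4 _ (norm_nonneg _) (by linarith)) (h4 _ (norm_nonneg _) (by linarith))
  obtain ⟨C, hC0, hC⟩ : ∃ C : ℝ, 0 ≤ C ∧ ∀ z ∈ K, ‖z.1 - z.2‖ ^ p ≤ C * D z := by
    have hpos : ∀ z ∈ K, 0 < D z := by
      rintro ⟨a, b⟩ hz
      refine sub_pos.2 (norm_half_add_rpow_lt hp fun h => ?_)
      have := hz.2
      simp only at this h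
      rw [h, sub_self, norm_zero, Real.zero_rpow hp0.ne'] at this
      linarith
    obtain ⟨C, hC⟩ := (hKc.image_of_continuousOn
      (hc2.continuousOn.div hDc.continuousOn fun z hz => (hpos z hz).ne')).bddAbove
    refine ⟨max C 0, le_max_right _ _, fun z hz => ?_⟩
    rw [← div_le_iff₀ (hpos z hz)]
    exact (hC (mem_image_of_mem _ hz)).trans (le_max_left _ _)
  refine ⟨C, hC0, fun a b => ?_⟩
  set S := ‖a‖ ^ p + ‖b‖ ^ p with hS
  have hS0 : 0 ≤ S := by positivity
  rcases hS0.eq_or_lt with h0 | hSpos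
  · have ha : ‖a‖ ^ p = 0 := by
      have h1 : 0 ≤ ‖a‖ ^ p := by positivity
      have h2 : 0 ≤ ‖b‖ ^ p := by positivity
      linarith
    have hb : ‖b‖ ^ p = 0 := by linarith
    rw [Real.rpow_eq_zero (norm_nonneg _) hp0.ne', norm_eq_zero] at ha hb
    rw [ha, hb, hS, ha, hb]
    simp [Real.zero_rpow hp0.ne']
  -- All terms are homogeneous of degree `p`, so `(a, b)` can be normalized to `S = 1`. Then either
  -- the pair lies in `K` or the `ε` term alone is enough.
  · set t := (S ^ (1 / p))⁻¹ with ht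
    have ht0 : 0 < t := by positivity
    have htp : t ^ p * S = 1 := by
      rw [ht, Real.inv_rpow (by positivity), ← Real.rpow_mul hS0, one_div_mul_cancel hp0.ne',
        Real.rpow_one, inv_mul_cancel₀ hSpos.ne']
    have hsm : ∀ x : F, ‖t • x‖ ^ p = t ^ p * ‖x‖ ^ p := fun x => by
      rw [norm_smul, Real.norm_of_nonneg ht0.le, Real.mul_rpow ht0.le (norm_nonneg _)]
    have hDt : D (t • a, t • b) = t ^ p * D (a, b) := by
      simp only [hD]
      rw [← smul_add, smul_comm, hsm, hsm, hsm]
      ring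
    have htpos : 0 < t ^ p := by positivity
    have key : t ^ p * ‖a - b‖ ^ p ≤ t ^ p * (ε * S + C * D (a, b)) := by
      rw [mul_add, mul_left_comm _ ε, htp, mul_left_comm _ C, ← hDt, ← hsm, smul_sub, mul_one]
      rcases le_or_gt ε (‖t • a - t • b‖ ^ p) with h | h
      · have := hC (t • a, t • b) ⟨by simp only [hsm]; rw [← mul_add, htp], h⟩
        simp only at this
        linarith
      · have := mul_nonneg hC0 (hDnn (t • a, t • b))
        linarith
    exact le_of_mul_le_mul_left key htpos

/-- The convexity inequality for `|·|^p / p`. -/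
theorem inner_norm_rpow_smul_sub_le [InnerProductSpace ℝ F] {p : ℝ} (hp : 1 < p) (a b : F) :
    inner ℝ (‖a‖ ^ (p - 2) • a) (b - a) ≤ 1 / p * ‖b‖ ^ p - 1 / p * ‖a‖ ^ p := by
  have hp0 : 0 < p := by linarith
  have hconj := Real.HolderConjugate.conjExponent hp
  rcases eq_or_ne a 0 with rfl | ha
  · simp only [smul_zero, inner_zero_left, norm_zero, Real.zero_rpow hp0.ne', mul_zero, sub_zero]
    positivity
  have ha0 : 0 < ‖a‖ := norm_pos_iff.2 ha
  have h1 : inner ℝ (‖a‖ ^ (p - 2) • a) a = ‖a‖ ^ p := by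
    rw [inner_smul_left, conj_trivial, real_inner_self_eq_norm_sq, ← Real.rpow_natCast,
      ← Real.rpow_add ha0]
    norm_num
  have h2 : inner ℝ (‖a‖ ^ (p - 2) • a) b ≤ ‖b‖ * ‖a‖ ^ (p - 1) := by
    refine (real_inner_le_norm _ _).trans (le_of_eq ?_)
    rw [norm_smul, Real.norm_of_nonneg (by positivity), ← Real.rpow_add_one ha0.ne', mul_comm]
    ring_nf
  have h3 := Real.young_inequality_of_nonneg (norm_nonneg b)
    (by positivity : 0 ≤ ‖a‖ ^ (p - 1)) hconj
  have h4 : (‖a‖ ^ (p - 1)) ^ p.conjExponent = ‖a‖ ^ p := by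
    rw [← Real.rpow_mul ha0.le, Real.conjExponent, mul_div_cancel₀ _ (by linarith)]
  have h5 : ‖a‖ ^ p / p.conjExponent = ‖a‖ ^ p - ‖a‖ ^ p / p := by
    rw [div_eq_mul_inv, ← hconj.one_sub_inv]
    ring
  rw [h4, h5] at h3
  rw [inner_sub_right, h1]
  rw [one_div_mul_eq_div, one_div_mul_eq_div]
  linarith

theorem norm_norm_rpow_smul [NormedSpace ℝ F] {p : ℝ} (hp : 1 < p) (a : F) :
    ‖‖a‖ ^ (p - 2) • a‖ = ‖a‖ ^ (p - 1) := by
  rcases eq_or_ne a 0 with rfl | ha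
  · simp [Real.zero_rpow (by linarith : p - 1 ≠ 0)]
  · rw [norm_smul, Real.norm_of_nonneg (by positivity),
      ← Real.rpow_add_one (norm_ne_zero_iff.2 ha)]
    ring_nf

/-- For `p < 2` the scalar factor is singular at `0`, but the norm of the product is `|a|^(p-1)`,
which tends to `0`. -/
theorem continuous_norm_rpow_smul [NormedSpace ℝ F] {p : ℝ} (hp : 1 < p) :
    Continuous fun a : F => ‖a‖ ^ (p - 2) • a := by
  rw [continuous_iff_continuousAt]
  intro a
  rcases eq_or_ne a 0 with rfl | ha
  · rw [ContinuousAt, smul_zero, tendsto_zero_iff_norm_tendsto_zero]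
    simp only [norm_norm_rpow_smul hp]
    have : Continuous fun a : F => ‖a‖ ^ (p - 1) :=
      continuous_norm.rpow_const fun _ => Or.inr (by linarith)
    simpa [Real.zero_rpow (by linarith : p - 1 ≠ 0)] using this.tendsto 0
  · exact (continuousAt_id.norm.rpow_const (Or.inl (norm_ne_zero_iff.2 ha))).smul continuousAt_id

end NormPower

/-! ### Uniform convexity of `L^p` by integration -/

section LpConvexity

variable {α F : Type*} [MeasurableSpace α] {μ : Measure α} [NormedAddCommGroup F]

theorem Lp.integrable_norm_rpow_ofReal {p : ℝ} (hp : 0 < p) (G : Lp F (ENNReal.ofReal p) μ) :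
    Integrable (fun x => ‖G x‖ ^ p) μ := by
  have := (Lp.memLp G).integrable_norm_rpow (by simpa using hp) ENNReal.ofReal_ne_top
  rwa [ENNReal.toReal_ofReal hp.le] at this

theorem Lp.norm_rpow_eq_integral {p : ℝ} (hp : 0 < p) (G : Lp F (ENNReal.ofReal p) μ) :
    ‖G‖ ^ p = ∫ x, ‖G x‖ ^ p ∂μ := by
  have h0 : 0 ≤ ∫ x, ‖G x‖ ^ p ∂μ := integral_nonneg fun _ => by positivity
  rw [Lp.norm_def, (Lp.memLp G).eLpNorm_eq_integral_rpow_norm (by simpa using hp)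
    ENNReal.ofReal_ne_top, ENNReal.toReal_ofReal hp.le, ENNReal.toReal_ofReal (by positivity),
    ← Real.rpow_mul h0, inv_mul_cancel₀ hp.ne', Real.rpow_one]

/-- Uniform convexity of `L^p`. -/
theorem Lp.exists_norm_sub_rpow_le [NormedSpace ℝ F] [StrictConvexSpace ℝ F]
    [FiniteDimensional ℝ F] {p : ℝ} (hp : 1 < p) {ε : ℝ} (hε : 0 < ε) :
    ∃ C : ℝ, 0 ≤ C ∧ ∀ a b : Lp F (ENNReal.ofReal p) μ,
      ‖a - b‖ ^ p ≤ ε * (‖a‖ ^ p + ‖b‖ ^ p) +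
        C * ((‖a‖ ^ p + ‖b‖ ^ p) / 2 - ‖(1 / 2 : ℝ) • (a + b)‖ ^ p) := by
  have hp0 : 0 < p := by linarith
  obtain ⟨C, hC0, hC⟩ := _root_.exists_norm_sub_rpow_le (F := F) hp hε
  refine ⟨C, hC0, fun a b => ?_⟩
  have ha := Lp.integrable_norm_rpow_ofReal hp0 a
  have hb := Lp.integrable_norm_rpow_ofReal hp0 b
  have hm := Lp.integrable_norm_rpow_ofReal hp0 ((1 / 2 : ℝ) • (a + b))
  have hab : Integrable (fun x => ‖a x‖ ^ p + ‖b x‖ ^ p) μ := ha.add hb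
  have hab2 : Integrable (fun x => (‖a x‖ ^ p + ‖b x‖ ^ p) / 2) μ := hab.div_const 2
  have hdef : Integrable (fun x => (‖a x‖ ^ p + ‖b x‖ ^ p) / 2 -
      ‖((1 / 2 : ℝ) • (a + b) : Lp F (ENNReal.ofReal p) μ) x‖ ^ p) μ := hab2.sub hm
  simp only [Lp.norm_rpow_eq_integral hp0]
  rw [← integral_add ha hb, ← integral_div, ← integral_sub hab2 hm,
    ← integral_const_mul, ← integral_const_mul,
    ← integral_add (hab.const_mul ε) (hdef.const_mul C)]
  refine integral_mono_ae (Lp.integrable_norm_rpow_ofReal hp0 (a - b))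
    ((hab.const_mul ε).add (hdef.const_mul C)) ?_
  filter_upwards [Lp.coeFn_sub a b, Lp.coeFn_smul (1 / 2 : ℝ) (a + b), Lp.coeFn_add a b]
    with x h1 h2 h3
  rw [h1, h2, Pi.smul_apply, h3]
  exact hC (a x) (b x)

end LpConvexity

/-! ### Minimization of uniformly convex energies -/

section DirectMethod

variable {H X : Type*} [NormedAddCommGroup H] [NormedSpace ℝ H]
  [NormedAddCommGroup X] [NormedSpace ℝ X]

/-- Coercivity: beyond the threshold `T` one has `t^p / p ≥ (K + 1) t`, which leaves `t ≤ c`. -/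
theorem exists_sublevel_bound {p K : ℝ} (hp : 1 < p) (hK : 0 ≤ K) (c : ℝ) :
    ∃ M : ℝ, 0 ≤ M ∧ ∀ t : ℝ, 0 ≤ t → 1 / p * t ^ p - K * t ≤ c → t ≤ M := by
  set T := (p * (K + 1)) ^ (1 / (p - 1)) with hT
  have hp1 : 0 < p - 1 := by linarith
  have hp0 : 0 < p := by linarith
  refine ⟨max T |c|, (abs_nonneg c).trans (le_max_right _ _), fun t ht h => ?_⟩
  rcases le_or_gt t T with h1 | h1
  · exact h1.trans (le_max_left _ _)
  · have hT0 : 0 < T := by positivity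
    have ht0 : 0 < t := hT0.trans h1
    have h2 : p * (K + 1) ≤ t ^ (p - 1) := by
      have h3 := Real.rpow_le_rpow hT0.le h1.le hp1.le
      rwa [hT, ← Real.rpow_mul (by positivity), one_div_mul_cancel hp1.ne', Real.rpow_one] at h3
    have h4 : t ^ p = t ^ (p - 1) * t := by
      rw [← Real.rpow_add_one ht0.ne']
      ring_nf
    have h5 : (K + 1) * t ≤ 1 / p * t ^ p := by
      rw [h4, one_div_mul_eq_div, le_div_iff₀ hp0]
      nlinarith
    refine le_trans ?_ (le_max_right T |c|)
    linarith [le_abs_self c]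

/-- The direct method for functionals `‖T w‖^p / p + Ψ w - f w`, with `Ψ` convex, nonnegative and
continuous, `T` bounded below and `‖·‖^p` uniformly convex. -/
theorem existsUnique_minimizer [CompleteSpace H] {p : ℝ} (hp : 1 < p) (T : H →L[ℝ] X) {C : ℝ}
    (hC : 0 ≤ C) (hT : ∀ w, ‖w‖ ≤ C * ‖T w‖)
    (hX : ∀ ε : ℝ, 0 < ε → ∃ C' : ℝ, 0 ≤ C' ∧ ∀ a b : X,
      ‖a - b‖ ^ p ≤ ε * (‖a‖ ^ p + ‖b‖ ^ p) +
        C' * ((‖a‖ ^ p + ‖b‖ ^ p) / 2 - ‖(1 / 2 : ℝ) • (a + b)‖ ^ p))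
    (Ψ : H → ℝ) (hΨ0 : ∀ w, 0 ≤ Ψ w) (hΨc : Continuous Ψ) (hΨ : ConvexOn ℝ univ Ψ)
    (f : StrongDual ℝ H) :
    ∃! u, ∀ w, 1 / p * ‖T u‖ ^ p + Ψ u - f u ≤ 1 / p * ‖T w‖ ^ p + Ψ w - f w := by
  have hp0 : 0 < p := by linarith
  set J : H → ℝ := fun w => 1 / p * ‖T w‖ ^ p + Ψ w - f w with hJ
  have hJc : Continuous J :=
    (((T.continuous.norm.rpow_const fun _ => Or.inr hp0.le).const_mul (1 / p)).add hΨc).sub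
      f.continuous
  have hlow : ∀ w, 1 / p * ‖T w‖ ^ p - ‖f‖ * C * ‖T w‖ ≤ J w := by
    intro w
    have h1 : f w ≤ ‖f‖ * C * ‖T w‖ := by
      refine (le_abs_self _).trans ((f.le_opNorm w).trans ?_)
      rw [mul_assoc]
      exact mul_le_mul_of_nonneg_left (hT w) (norm_nonneg f)
    have := hΨ0 w
    simp only [hJ]
    linarith
  have hsub : ∀ c : ℝ, ∃ M : ℝ, 0 ≤ M ∧ ∀ w, J w ≤ c → ‖T w‖ ≤ M := by
    intro c
    obtain ⟨M, hM0, hM⟩ := exists_sublevel_bound hp (by positivity : 0 ≤ ‖f‖ * C) c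
    exact ⟨M, hM0, fun w hw => hM _ (norm_nonneg _) ((hlow w).trans hw)⟩
  have hbdd : BddBelow (range J) := by
    obtain ⟨M, hM0, hM⟩ := hsub 0
    refine ⟨min 0 (-(‖f‖ * C * M)), ?_⟩
    rintro _ ⟨w, rfl⟩
    rcases le_or_gt (J w) 0 with h | h
    · refine (min_le_right _ _).trans (le_trans ?_ (hlow w))
      have h1 : ‖f‖ * C * ‖T w‖ ≤ ‖f‖ * C * M :=
        mul_le_mul_of_nonneg_left (hM w h) (by positivity)
      have h2 : 0 ≤ 1 / p * ‖T w‖ ^ p := by positivity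
      linarith
    · exact (min_le_left _ _).trans h.le
  set m := sInf (range J) with hm
  have hmle : ∀ w, m ≤ J w := fun w => csInf_le hbdd (mem_range_self w)
  obtain ⟨M, hM0, hM⟩ := hsub (m + 1)
  -- The heart of the method: near-minimizers are close in norm. Existence and uniqueness both
  -- follow from it.
  have hgap : ∀ ε : ℝ, 0 < ε → ∃ δ : ℝ, 0 < δ ∧ ∀ u w, J u ≤ m + δ → J w ≤ m + δ →
      ‖u - w‖ < ε := by
    intro ε hε
    set ρ := ε / (C + 1) with hρ
    have hρ0 : 0 < ρ := by positivity
    have hρp : 0 < ρ ^ p := by positivity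
    -- With this parameter the first term of the convexity bound is at most `ρ^p / 2`; the choice of
    -- `δ` makes the second at most `ρ^p / 4`. The cap `δ ≤ 1` keeps both points in the sublevel set
    -- bounded by `M`.
    obtain ⟨C', hC'0, hC'⟩ := hX (ρ ^ p / (4 * (M ^ p + 1))) (by positivity)
    refine ⟨min 1 (ρ ^ p / (4 * (p * C' + 1))), lt_min one_pos (by positivity),
      fun u w hu hw => ?_⟩
    set δ := min 1 (ρ ^ p / (4 * (p * C' + 1))) with hδ
    have hu1 : ‖T u‖ ^ p ≤ M ^ p := Real.rpow_le_rpow (norm_nonneg _)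
      (hM u (hu.trans (by linarith [min_le_left 1 (ρ ^ p / (4 * (p * C' + 1)))]))) hp0.le
    have hw1 : ‖T w‖ ^ p ≤ M ^ p := Real.rpow_le_rpow (norm_nonneg _)
      (hM w (hw.trans (by linarith [min_le_left 1 (ρ ^ p / (4 * (p * C' + 1)))]))) hp0.le
    have hmid : (‖T u‖ ^ p + ‖T w‖ ^ p) / 2 - ‖(1 / 2 : ℝ) • (T u + T w)‖ ^ p ≤ p * δ := by
      -- The midpoint has energy at least `m`, while `Ψ` is convex and `f` linear, so the whole
      -- deficit of `|T ·|^p / p` is at most `δ`.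
      have h1 := hmle ((1 / 2 : ℝ) • (u + w))
      have h2 := hΨ.2 (mem_univ u) (mem_univ w) (by norm_num : (0 : ℝ) ≤ 1 / 2)
        (by norm_num : (0 : ℝ) ≤ 1 / 2) (by norm_num)
      rw [← smul_add] at h2
      simp only [hJ, map_smul, map_add, smul_eq_mul] at h1 h2 hu hw
      have h3 : 1 / p * ((‖T u‖ ^ p + ‖T w‖ ^ p) / 2 - ‖(1 / 2 : ℝ) • (T u + T w)‖ ^ p) ≤ δ := by
        linarith
      rwa [one_div_mul_eq_div, div_le_iff₀ hp0, mul_comm δ] at h3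
    have h4 : ‖T u - T w‖ ^ p < ρ ^ p := by
      have h5 := hC' (T u) (T w)
      have h6 : ρ ^ p / (4 * (M ^ p + 1)) * (‖T u‖ ^ p + ‖T w‖ ^ p) ≤ ρ ^ p / 2 := by
        have hMp : 0 ≤ M ^ p := by positivity
        rw [div_mul_eq_mul_div, div_le_div_iff₀ (by positivity) (by norm_num)]
        nlinarith
      have h7 : C' * ((‖T u‖ ^ p + ‖T w‖ ^ p) / 2 - ‖(1 / 2 : ℝ) • (T u + T w)‖ ^ p) ≤
          ρ ^ p / 4 := by
        have h8 := mul_le_mul_of_nonneg_left hmid hC'0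
        have h9 : C' * (p * δ) ≤ (p * C') * (ρ ^ p / (4 * (p * C' + 1))) := by
          rw [mul_left_comm, ← mul_assoc]
          exact mul_le_mul_of_nonneg_left (min_le_right _ _) (by positivity)
        have h10 : (p * C') * (ρ ^ p / (4 * (p * C' + 1))) ≤ ρ ^ p / 4 := by
          rw [← mul_div_assoc, div_le_div_iff₀ (by positivity) (by norm_num)]
          nlinarith
        linarith
      linarith
    have h11 : ‖T u - T w‖ < ρ := lt_of_not_ge fun h =>
      absurd h4 (not_lt.2 (Real.rpow_le_rpow hρ0.le h hp0.le))
    calc ‖u - w‖ ≤ C * ‖T (u - w)‖ := hT _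
      _ ≤ C * ρ := by
        rw [map_sub]
        exact mul_le_mul_of_nonneg_left h11.le hC
      _ < (C + 1) * ρ := by linarith
      _ = ε := by rw [hρ, mul_div_cancel₀ _ (by positivity)]
  have hex : ∀ n : ℕ, ∃ w, J w < m + 1 / ((n : ℝ) + 1) := by
    intro n
    obtain ⟨_, ⟨w, rfl⟩, hw⟩ := exists_lt_of_csInf_lt (range_nonempty J)
      (lt_add_of_pos_right m (by positivity : (0 : ℝ) < 1 / ((n : ℝ) + 1)))
    exact ⟨w, hw⟩
  choose x hx using hex
  have hcau : CauchySeq x := by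
    refine Metric.cauchySeq_iff'.2 fun ε hε => ?_
    obtain ⟨δ, hδ, h⟩ := hgap ε hε
    obtain ⟨N, hN⟩ := exists_nat_one_div_lt hδ
    refine ⟨N, fun n hn => ?_⟩
    rw [dist_eq_norm]
    refine h _ _ ((hx n).le.trans ?_) ((hx N).le.trans ?_)
    · have : 1 / ((n : ℝ) + 1) ≤ 1 / ((N : ℝ) + 1) := Nat.one_div_le_one_div hn
      linarith
    · linarith
  obtain ⟨u, hu⟩ := cauchySeq_tendsto_of_complete hcau
  have hJu : J u ≤ m := by
    have h1 : Tendsto (fun n : ℕ => m + 1 / ((n : ℝ) + 1)) atTop (𝓝 (m + 0)) :=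
      tendsto_one_div_add_atTop_nhds_zero_nat.const_add m
    rw [add_zero] at h1
    exact le_of_tendsto_of_tendsto' ((hJc.tendsto u).comp hu) h1 fun n => (hx n).le
  refine ⟨u, fun w => hJu.trans (hmle w), fun w hw => ?_⟩
  have hJw : J w ≤ m := (hw u).trans hJu
  by_contra hne
  obtain ⟨δ, hδ, h⟩ := hgap ‖w - u‖ (norm_pos_iff.2 (sub_ne_zero.2 hne))
  exact lt_irrefl _ (h w u (by linarith) (by linarith))

end DirectMethod

/-! ### Finiteness, continuity and convexity of `Ψ_v` -/

section Obstacle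

variable {d : ℕ} {q q' : ℝ≥0∞} {lp lm v : EuclideanSpace ℝ (Fin d) → ℝ}

theorem integrable_psiIntegrand {μ : Measure (EuclideanSpace ℝ (Fin d))}
    (hqq' : q.HolderConjugate q') (hv : MemLp v q' μ) (hlp : MemLp lp q μ) (hlm : MemLp lm q μ)
    {w : EuclideanSpace ℝ (Fin d) → ℝ} (hw : MemLp w q' μ) :
    Integrable (psiIntegrand lp lm v w) μ := by
  have h1 : MemLp (fun x => max (w x - v x) 0) q' μ := (hw.sub hv).pos_part
  have h2 : MemLp (fun x => max (-(w x - v x)) 0) q' μ := (hw.sub hv).neg_part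
  exact (hlp.integrable_mul h1).add (hlm.integrable_mul h2)

theorem abs_psiIntegrand_sub_le (lp lm v w w' : EuclideanSpace ℝ (Fin d) → ℝ)
    (x : EuclideanSpace ℝ (Fin d)) :
    |psiIntegrand lp lm v w x - psiIntegrand lp lm v w' x| ≤ (|lp x| + |lm x|) * |w x - w' x| := by
  have h1 : |max (w x - v x) 0 - max (w' x - v x) 0| ≤ |w x - w' x| := by
    refine (abs_max_sub_max_le_abs _ _ _).trans (le_of_eq ?_)
    rw [sub_sub_sub_cancel_right]
  have h2 : |max (-(w x - v x)) 0 - max (-(w' x - v x)) 0| ≤ |w x - w' x| := by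
    refine (abs_max_sub_max_le_abs _ _ _).trans (le_of_eq ?_)
    rw [neg_sub_neg, sub_sub_sub_cancel_right, abs_sub_comm]
  have h3 : psiIntegrand lp lm v w x - psiIntegrand lp lm v w' x =
      lp x * (max (w x - v x) 0 - max (w' x - v x) 0) +
        lm x * (max (-(w x - v x)) 0 - max (-(w' x - v x)) 0) := by
    simp only [psiIntegrand]
    ring
  rw [h3, add_mul]
  refine (abs_add_le _ _).trans (add_le_add ?_ ?_) <;> rw [abs_mul]
  · exact mul_le_mul_of_nonneg_left h1 (abs_nonneg _)
  · exact mul_le_mul_of_nonneg_left h2 (abs_nonneg _)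

theorem abs_integral_psiIntegrand_sub_le {μ : Measure (EuclideanSpace ℝ (Fin d))}
    (hqq' : q.HolderConjugate q') (hv : MemLp v q' μ) (hlp : MemLp lp q μ) (hlm : MemLp lm q μ)
    {w w' : EuclideanSpace ℝ (Fin d) → ℝ} (hw : MemLp w q' μ) (hw' : MemLp w' q' μ) :
    |∫ x, psiIntegrand lp lm v w x ∂μ - ∫ x, psiIntegrand lp lm v w' x ∂μ| ≤
      (eLpNorm (fun x => |lp x| + |lm x|) q μ * eLpNorm (w - w') q' μ).toReal := by
  have hl : MemLp (fun x => |lp x| + |lm x|) q μ := hlp.norm.add hlm.norm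
  have hd : MemLp (w - w') q' μ := hw.sub hw'
  rw [← integral_sub (integrable_psiIntegrand hqq' hv hlp hlm hw)
    (integrable_psiIntegrand hqq' hv hlp hlm hw'), ← Real.norm_eq_abs]
  refine (norm_integral_le_lintegral_norm _).trans
    (ENNReal.toReal_mono (ENNReal.mul_ne_top hl.2.ne hd.2.ne) ?_)
  have h1 : eLpNorm ((fun x => |lp x| + |lm x|) • (w - w')) 1 μ ≤ _ :=
    eLpNorm_smul_le_mul_eLpNorm hd.1 hl.1 (p := q) (q := q')
  refine le_trans ?_ h1
  rw [eLpNorm_one_eq_lintegral_enorm]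
  refine lintegral_mono fun x => ?_
  rw [ofReal_norm, enorm_le_iff_norm_le]
  refine (abs_psiIntegrand_sub_le lp lm v w w' x).trans (le_of_eq ?_)
  rw [Pi.smul_apply', smul_eq_mul, norm_mul, Real.norm_of_nonneg (by positivity), Pi.sub_apply,
    Real.norm_eq_abs]

theorem max_combo_zero_le {a b t u : ℝ} (ha : 0 ≤ a) (hb : 0 ≤ b) :
    max (a * t + b * u) 0 ≤ a * max t 0 + b * max u 0 := by
  refine max_le (add_le_add ?_ ?_) (by positivity)
  · exact mul_le_mul_of_nonneg_left (le_max_left _ _) ha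
  · exact mul_le_mul_of_nonneg_left (le_max_left _ _) hb

theorem psiIntegrand_combo_le {w u u' : EuclideanSpace ℝ (Fin d) → ℝ}
    {x : EuclideanSpace ℝ (Fin d)} {a b : ℝ} (hlp : 0 ≤ lp x) (hlm : 0 ≤ lm x) (ha : 0 ≤ a)
    (hb : 0 ≤ b) (hab : a + b = 1) (hw : w x = a * u x + b * u' x) :
    psiIntegrand lp lm v w x ≤
      a * psiIntegrand lp lm v u x + b * psiIntegrand lp lm v u' x := by
  have e1 : w x - v x = a * (u x - v x) + b * (u' x - v x) := by
    rw [hw]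
    linear_combination v x * hab
  have e2 : -(w x - v x) = a * (-(u x - v x)) + b * (-(u' x - v x)) := by
    rw [e1]
    ring
  have h1 := mul_le_mul_of_nonneg_left
    (max_combo_zero_le (t := u x - v x) (u := u' x - v x) ha hb) hlp
  have h2 := mul_le_mul_of_nonneg_left
    (max_combo_zero_le (t := -(u x - v x)) (u := -(u' x - v x)) ha hb) hlm
  rw [← e1] at h1
  rw [← e2] at h2
  simp only [psiIntegrand]
  linarith

variable {s p : ℝ} [Fact (1 < p)] {Ω : Opens (EuclideanSpace ℝ (Fin d))}

theorem LionsCalderon.memLp_fn [NeZero d] (hs0 : 0 < s) (hs1 : s ≤ 1)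
    (hΩ : Bornology.IsBounded (Ω : Set (EuclideanSpace ℝ (Fin d)))) {r : ℝ≥0∞}
    (hr : r < sobolevExponent d s p) (w : LionsCalderon s p Ω) :
    MemLp w.fn r (volume.restrict Ω) := by
  obtain ⟨C, hC⟩ := exists_eLpNorm_fn_le (p := p) hs0 hs1 hΩ hr
  have h : MemLp w.fn r volume := ⟨Lp.aestronglyMeasurable _,
    (hC w).trans_lt (ENNReal.mul_lt_top ENNReal.coe_lt_top enorm_lt_top)⟩
  exact h.restrict _

theorem LionsCalderon.fn_sub (u w : LionsCalderon s p Ω) :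
    (u - w).fn =ᵐ[volume] u.fn - w.fn :=
  Lp.coeFn_sub (u : LpPair d p).fst (w : LpPair d p).fst

/-- Both `t^+` and `t^-` are 1-Lipschitz, so Hölder followed by the Sobolev inequality for `q'`
makes `Ψ_v` Lipschitz. -/
theorem continuous_psiFunctional [NeZero d] (hs0 : 0 < s) (hs1 : s ≤ 1)
    (hΩ : Bornology.IsBounded (Ω : Set (EuclideanSpace ℝ (Fin d))))
    (hqq' : q.HolderConjugate q') (hq' : q' < sobolevExponent d s p)
    (hv : MemLp v q' (volume.restrict Ω)) (hlp : MemLp lp q (volume.restrict Ω))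
    (hlm : MemLp lm q (volume.restrict Ω)) :
    Continuous (psiFunctional lp lm v : LionsCalderon s p Ω → ℝ) := by
  obtain ⟨C, hC⟩ := exists_eLpNorm_fn_le (p := p) hs0 hs1 hΩ hq'
  set N := eLpNorm (fun x => |lp x| + |lm x|) q (volume.restrict Ω) with hN
  have hNtop : N ≠ ∞ := (hlp.norm.add hlm.norm).2.ne
  have hmem := LionsCalderon.memLp_fn (p := p) (Ω := Ω) hs0 hs1 hΩ hq'
  have hle : ∀ u w : LionsCalderon s p Ω,
      |psiFunctional lp lm v u - psiFunctional lp lm v w| ≤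
        N.toReal * (C * ‖LionsCalderon.gradL s p Ω (u - w)‖) := by
    intro u w
    refine (abs_integral_psiIntegrand_sub_le hqq' hv hlp hlm (hmem u) (hmem w)).trans ?_
    rw [ENNReal.toReal_mul]
    refine mul_le_mul_of_nonneg_left ?_ ENNReal.toReal_nonneg
    have h1 : eLpNorm (u.fn - w.fn) q' (volume.restrict Ω) ≤
        C * ‖LionsCalderon.gradL s p Ω (u - w)‖ₑ := by
      refine (eLpNorm_mono_measure _ Measure.restrict_le_self).trans ?_
      rw [← eLpNorm_congr_ae (LionsCalderon.fn_sub u w)]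
      exact hC (u - w)
    have h2 := ENNReal.toReal_mono (ENNReal.mul_ne_top ENNReal.coe_ne_top enorm_ne_top) h1
    simpa using h2
  rw [continuous_iff_continuousAt]
  intro w
  rw [ContinuousAt, tendsto_iff_norm_sub_tendsto_zero]
  have hc : Continuous fun u : LionsCalderon s p Ω =>
      N.toReal * (C * ‖LionsCalderon.gradL s p Ω (u - w)‖) := by fun_prop
  refine squeeze_zero (fun u => norm_nonneg _) (fun u => hle u w) ?_
  simpa using hc.tendsto w

theorem psiFunctional_nonneg (hlp0 : ∀ᵐ x ∂volume.restrict (Ω : Set _), 0 ≤ lp x)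
    (hlm0 : ∀ᵐ x ∂volume.restrict (Ω : Set _), 0 ≤ lm x) (w : LionsCalderon s p Ω) :
    0 ≤ psiFunctional lp lm v w := by
  refine integral_nonneg_of_ae ?_
  filter_upwards [hlp0, hlm0] with x h1 h2
  simp only [psiIntegrand, Pi.zero_apply]
  positivity

theorem convexOn_psiFunctional [NeZero d] (hs0 : 0 < s) (hs1 : s ≤ 1)
    (hΩ : Bornology.IsBounded (Ω : Set (EuclideanSpace ℝ (Fin d))))
    (hqq' : q.HolderConjugate q') (hq' : q' < sobolevExponent d s p)
    (hv : MemLp v q' (volume.restrict Ω)) (hlp : MemLp lp q (volume.restrict Ω))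
    (hlm : MemLp lm q (volume.restrict Ω))
    (hlp0 : ∀ᵐ x ∂volume.restrict (Ω : Set _), 0 ≤ lp x)
    (hlm0 : ∀ᵐ x ∂volume.restrict (Ω : Set _), 0 ≤ lm x) :
    ConvexOn ℝ univ (psiFunctional lp lm v : LionsCalderon s p Ω → ℝ) := by
  refine ⟨convex_univ, fun u _ w _ a b ha hb hab => ?_⟩
  have hint := fun w : LionsCalderon s p Ω => integrable_psiIntegrand hqq' hv hlp hlm
    (LionsCalderon.memLp_fn hs0 hs1 hΩ hq' w)
  simp only [psiFunctional, smul_eq_mul]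
  rw [← integral_const_mul, ← integral_const_mul,
    ← integral_add ((hint u).const_mul a) ((hint w).const_mul b)]
  refine integral_mono_ae (hint _) (((hint u).const_mul a).add ((hint w).const_mul b)) ?_
  have h1 : (a • u + b • w).fn =ᵐ[volume] fun x => a * u.fn x + b * w.fn x := by
    filter_upwards [Lp.coeFn_add (a • (u : LpPair d p).fst) (b • (w : LpPair d p).fst),
      Lp.coeFn_smul a (u : LpPair d p).fst, Lp.coeFn_smul b (w : LpPair d p).fst] with x h1 h2 h3
    refine h1.trans ?_
    rw [Pi.add_apply, h2, h3]
    rfl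
  filter_upwards [hlp0, hlm0, ae_restrict_of_ae h1] with x h1 h2 h3
  exact psiIntegrand_combo_le h1 h2 ha hb hab h3

end Obstacle

/-! ### Variational inequality versus minimization -/

section VariationalInequality

variable {d : ℕ} {s p : ℝ} [hp : Fact (1 < p)] {Ω : Opens (EuclideanSpace ℝ (Fin d))}

/-- A majorant independent of `t`, for dominated convergence along segments; at `t = 0` it also
gives integrability of the pairing. -/
theorem abs_inner_norm_rpow_smul_le {F : Type*} [NormedAddCommGroup F] [InnerProductSpace ℝ F]
    {p : ℝ} (hp : 1 < p) (a b : F) {t : ℝ} (ht0 : 0 ≤ t) (ht1 : t ≤ 1) :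
    ‖(inner ℝ (‖a + t • b‖ ^ (p - 2) • (a + t • b)) b : ℝ)‖ ≤ (‖a‖ + ‖b‖) ^ p := by
  have h1 : ‖a + t • b‖ ≤ ‖a‖ + ‖b‖ := by
    refine (norm_add_le _ _).trans (add_le_add le_rfl ?_)
    rw [norm_smul, Real.norm_of_nonneg ht0]
    exact mul_le_of_le_one_left (norm_nonneg b) ht1
  refine (norm_inner_le_norm _ _).trans ?_
  rw [norm_norm_rpow_smul hp]
  have h2 : (‖a‖ + ‖b‖) ^ p = (‖a‖ + ‖b‖) ^ (p - 1) * (‖a‖ + ‖b‖) := by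
    have h0 : 0 ≤ ‖a‖ + ‖b‖ := by positivity
    conv_rhs => rw [← Real.rpow_one (‖a‖ + ‖b‖), ← Real.rpow_mul h0, one_mul]
    rw [← Real.rpow_add' h0 (by linarith)]
    ring_nf
  rw [h2]
  exact mul_le_mul (Real.rpow_le_rpow (norm_nonneg _) h1 (by linarith))
    (le_add_of_nonneg_left (norm_nonneg a)) (norm_nonneg _) (by positivity)

theorem LionsCalderon.memLp_grad (u : LionsCalderon s p Ω) :
    MemLp u.grad (ENNReal.ofReal p) volume :=
  Lp.memLp _

theorem LionsCalderon.integrable_add_norm_rpow (u w : LionsCalderon s p Ω) :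
    Integrable fun x => (‖u.grad x‖ + ‖w.grad x‖) ^ p := by
  have hp0 : 0 < p := by linarith [hp.out]
  have h : MemLp (fun x => ‖u.grad x‖ + ‖w.grad x‖) (ENNReal.ofReal p) volume :=
    u.memLp_grad.norm.add w.memLp_grad.norm
  have h2 := h.integrable_norm_rpow (by simpa using hp0) ENNReal.ofReal_ne_top
  rw [ENNReal.toReal_ofReal hp0.le] at h2
  refine h2.congr (Eventually.of_forall fun x => ?_)
  simp only
  rw [Real.norm_of_nonneg (by positivity)]

theorem LionsCalderon.aestronglyMeasurable_inner (u w : LionsCalderon s p Ω) (t : ℝ) :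
    AEStronglyMeasurable (fun x => (inner ℝ (‖u.grad x + t • w.grad x‖ ^ (p - 2) •
      (u.grad x + t • w.grad x)) (w.grad x) : ℝ)) volume :=
  ((continuous_norm_rpow_smul hp.out).comp_aestronglyMeasurable
    (u.memLp_grad.1.add (w.memLp_grad.1.const_smul t))).inner w.memLp_grad.1

theorem LionsCalderon.integrable_inner (u w : LionsCalderon s p Ω) :
    Integrable fun x => (inner ℝ (‖u.grad x‖ ^ (p - 2) • u.grad x) (w.grad x) : ℝ) := by
  refine (u.integrable_add_norm_rpow w).mono' ?_ (Eventually.of_forall fun x => ?_)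
  · simpa using u.aestronglyMeasurable_inner w 0
  · simpa using abs_inner_norm_rpow_smul_le hp.out (u.grad x) (w.grad x) le_rfl zero_le_one

theorem LionsCalderon.integrable_norm_grad_rpow (u : LionsCalderon s p Ω) :
    Integrable fun x => ‖u.grad x‖ ^ p :=
  Lp.integrable_norm_rpow_ofReal (by linarith [hp.out]) _

theorem LionsCalderon.grad_add_smul (u w : LionsCalderon s p Ω) (t : ℝ) :
    (u + t • w).grad =ᵐ[volume] fun x => u.grad x + t • w.grad x := by
  filter_upwards [Lp.coeFn_add (u : LpPair d p).snd (t • (w : LpPair d p).snd),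
    Lp.coeFn_smul t (w : LpPair d p).snd] with x h1 h2
  refine h1.trans ?_
  rw [Pi.add_apply, h2]
  rfl

theorem LionsCalderon.grad_sub (u w : LionsCalderon s p Ω) :
    (u - w).grad =ᵐ[volume] fun x => u.grad x - w.grad x :=
  Lp.coeFn_sub (u : LpPair d p).snd (w : LpPair d p).snd

/-- `-Δ^s_p` is a subgradient of the Dirichlet energy. -/
theorem neg_fracPLaplacian_sub_le (u w : LionsCalderon s p Ω) :
    -fracPLaplacian u (w - u) ≤
      1 / p * (∫ x, ‖w.grad x‖ ^ p) - 1 / p * ∫ x, ‖u.grad x‖ ^ p := by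
  change - -∫ x, (inner ℝ (‖u.grad x‖ ^ (p - 2) • u.grad x) ((w - u).grad x) : ℝ) ≤ _
  have hw := w.integrable_norm_grad_rpow.const_mul (1 / p)
  have hu := u.integrable_norm_grad_rpow.const_mul (1 / p)
  rw [neg_neg, ← integral_const_mul, ← integral_const_mul, ← integral_sub hw hu]
  refine integral_mono_ae (u.integrable_inner (w - u)) (hw.sub hu) ?_
  filter_upwards [LionsCalderon.grad_sub w u] with x hx
  rw [hx]
  exact inner_norm_rpow_smul_sub_le hp.out _ _

theorem tendsto_fracPLaplacian_add_smul (u h : LionsCalderon s p Ω) :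
    Tendsto (fun t : ℝ => fracPLaplacian (u + t • h) h) (𝓝[>] 0) (𝓝 (fracPLaplacian u h)) := by
  have heq : ∀ t : ℝ, fracPLaplacian (u + t • h) h =
      -∫ x, (inner ℝ (‖u.grad x + t • h.grad x‖ ^ (p - 2) • (u.grad x + t • h.grad x))
        (h.grad x) : ℝ) := by
    intro t
    change -∫ x, (inner ℝ (‖(u + t • h).grad x‖ ^ (p - 2) • (u + t • h).grad x)
      (h.grad x) : ℝ) = _
    congr 1
    refine integral_congr_ae ?_
    filter_upwards [u.grad_add_smul h t] with x hx
    rw [hx]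
  simp only [heq]
  refine Tendsto.neg ?_
  refine tendsto_integral_filter_of_dominated_convergence _
    (Eventually.of_forall fun t => u.aestronglyMeasurable_inner h t) ?_
    (u.integrable_add_norm_rpow h) (Eventually.of_forall fun x => ?_)
  · filter_upwards [Ioo_mem_nhdsGT (zero_lt_one' ℝ)] with t ht
    exact Eventually.of_forall fun x => abs_inner_norm_rpow_smul_le hp.out _ _ ht.1.le ht.2.le
  · have hc : Continuous fun t : ℝ => (inner ℝ (‖u.grad x + t • h.grad x‖ ^ (p - 2) •
        (u.grad x + t • h.grad x)) (h.grad x) : ℝ) :=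
      ((continuous_norm_rpow_smul hp.out).comp
        (continuous_const.add (continuous_id.smul continuous_const))).inner continuous_const
    have := (hc.tendsto 0).mono_left (nhdsWithin_le_nhds (s := Ioi 0))
    simpa using this

variable {lp lm v : EuclideanSpace ℝ (Fin d) → ℝ}

/-- The energy is never differentiated: the subgradient inequality is used at `u` in one direction
and at nearby points of the segment from `u` to `w` in the other. -/
theorem variationalInequality_iff_isMin
    (hconv : ConvexOn ℝ univ (psiFunctional lp lm v : LionsCalderon s p Ω → ℝ))
    (f : StrongDual ℝ (LionsCalderon s p Ω)) (u : LionsCalderon s p Ω) :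
    (∀ w : LionsCalderon s p Ω,
      psiFunctional lp lm v w - psiFunctional lp lm v u ≥ (f + fracPLaplacian u) (w - u)) ↔
    ∀ w : LionsCalderon s p Ω,
      energyFunctional lp lm v f u ≤ energyFunctional lp lm v f w := by
  constructor
  · intro h w
    have h1 := h w
    have h2 := neg_fracPLaplacian_sub_le u w
    rw [add_apply, map_sub f] at h1
    simp only [energyFunctional]
    linarith
  · intro h w
    -- Minimality against `u + t (w - u)`, the subgradient inequality based at that point, and
    -- convexity of `Ψ_v` all scale with `t`, which is divided out before `t → 0`.
    have key : ∀ t ∈ Ioo (0 : ℝ) 1, (f + fracPLaplacian (u + t • (w - u))) (w - u) ≤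
        psiFunctional lp lm v w - psiFunctional lp lm v u := by
      intro t ht
      have h1 := h (u + t • (w - u))
      have h2 := neg_fracPLaplacian_sub_le (u + t • (w - u)) u
      have h3 := hconv.2 (mem_univ u) (mem_univ w) (by linarith [ht.2] : (0 : ℝ) ≤ 1 - t) ht.1.le
        (by ring)
      rw [show (1 - t) • u + t • w = u + t • (w - u) by module] at h3
      rw [show u - (u + t • (w - u)) = (-t) • (w - u) by module, map_smul] at h2
      simp only [energyFunctional, map_add, map_smul f, smul_eq_mul] at h1 h2 h3
      have h4 : t * (f (w - u) + fracPLaplacian (u + t • (w - u)) (w - u)) ≤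
          t * (psiFunctional lp lm v w - psiFunctional lp lm v u) := by linarith
      exact le_of_mul_le_mul_left h4 ht.1
    refine le_of_tendsto ((tendsto_fracPLaplacian_add_smul u (w - u)).const_add (f (w - u))) ?_
    filter_upwards [Ioo_mem_nhdsGT (zero_lt_one' ℝ)] with t ht
    exact key t ht

theorem energyFunctional_eq (f : StrongDual ℝ (LionsCalderon s p Ω)) (w : LionsCalderon s p Ω) :
    energyFunctional lp lm v f w =
      1 / p * ‖LionsCalderon.gradL s p Ω w‖ ^ p + psiFunctional lp lm v w - f w := by
  rw [energyFunctional, Lp.norm_rpow_eq_integral (by linarith [hp.out])]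
  rfl

end VariationalInequality

end

theorem proposition3p1 {d : ℕ} (hd : 0 < d) (Ω : Opens (EuclideanSpace ℝ (Fin d)))
    (hΩ : Bornology.IsBounded (Ω : Set (EuclideanSpace ℝ (Fin d))))
    (s : ℝ) (hs0 : 0 < s) (hs1 : s ≤ 1) (p : ℝ) [Fact (1 < p)]
    (q q' : ℝ≥0∞) (hqq' : q.HolderConjugate q') (hq' : q' < sobolevExponent d s p)
    (v lp lm : EuclideanSpace ℝ (Fin d) → ℝ)
    (hv : MemLp v q' (volume.restrict Ω))
    (hlp : MemLp lp q (volume.restrict Ω)) (hlm : MemLp lm q (volume.restrict Ω))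
    (hlp0 : ∀ᵐ x ∂volume.restrict Ω, 0 ≤ lp x) (hlm0 : ∀ᵐ x ∂volume.restrict Ω, 0 ≤ lm x)
    (f : StrongDual ℝ (LionsCalderon s p Ω)) :
    -- `Ψ_v` is finite on the whole space
    (∀ w : LionsCalderon s p Ω, IntegrableOn (psiIntegrand lp lm v w.fn) Ω volume) ∧
    -- the variational inequality has exactly one solution
    (∃! u : LionsCalderon s p Ω, ∀ w : LionsCalderon s p Ω,
      psiFunctional lp lm v w - psiFunctional lp lm v u ≥ (f + fracPLaplacian u) (w - u)) ∧
    -- the solution satisfies, and is characterised by, the subdifferential inclusion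
    (∀ u : LionsCalderon s p Ω,
      (∀ w : LionsCalderon s p Ω,
        psiFunctional lp lm v w - psiFunctional lp lm v u ≥ (f + fracPLaplacian u) (w - u)) ↔
      f + fracPLaplacian u ∈ subdifferential (psiFunctional lp lm v) u) ∧
    -- the solution is the minimiser of the energy
    (∀ u : LionsCalderon s p Ω,
      (∀ w : LionsCalderon s p Ω,
        psiFunctional lp lm v w - psiFunctional lp lm v u ≥ (f + fracPLaplacian u) (w - u)) ↔
      ∀ w : LionsCalderon s p Ω, energyFunctional lp lm v f u ≤ energyFunctional lp lm v f w) := by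
  have : NeZero d := ⟨hd.ne'⟩
  have hp : 1 < p := Fact.out
  have hconv := convexOn_psiFunctional (s := s) (p := p) hs0 hs1 hΩ hqq' hq' hv hlp hlm hlp0 hlm0
  refine ⟨fun w => integrable_psiIntegrand hqq' hv hlp hlm (w.memLp_fn hs0 hs1 hΩ hq'), ?_,
    fun u => ?_, variationalInequality_iff_isMin hconv f⟩
  -- Unique solvability becomes unique minimization; Poincaré's inequality makes the gradient map
  -- bounded below, as the direct method requires.
  · simp only [variationalInequality_iff_isMin hconv f, energyFunctional_eq]
    obtain ⟨C, hC, hT⟩ := exists_norm_le_gradL (s := s) (p := p) hs0 hs1 hΩ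
    have : CompleteSpace (LionsCalderon s p Ω) :=
      (Submodule.isClosed_topologicalClosure _).completeSpace_coe
    exact existsUnique_minimizer hp (LionsCalderon.gradL s p Ω) hC hT
      (fun ε hε => Lp.exists_norm_sub_rpow_le hp hε) _ (psiFunctional_nonneg hlp0 hlm0)
      (continuous_psiFunctional hs0 hs1 hΩ hqq' hq' hv hlp hlm) hconv f
  · refine forall_congr' fun w => ?_
    rw [ge_iff_le, le_sub_iff_add_le, add_comm]
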